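/- **Conventions.** Let $Y$ be a Banach space (real or complex), resp. an operator space (a complex Banach space with norms on the matrix spaces $M_n(Y)$ satisfying Ruan's axioms), and $X\subset Y$ a closed subspace. $X^\perp\subset Y^*$ is the annihilator, and $X^{**}=X^{\perp\perp}\subset Y^{**}$. Duals of operator spaces carry the dual structure $M_n(Y^*)=CB(Y,M_n)$. A closed subspace $V$ of $E$ is an *M-summand* if $E=V\oplus Z$ for a closed subspace $Z$ with $\|v+z\|=\max\{\|v\|,\|z\|\}$ for $v\in V$, $z\in Z$; it is a *complete M-summand* if moreover $\|(v_{ij}+z_{ij})\|=\max\{\|(v_{ij})\|,\|(z_{ij})\|\}$ for all $n\times n$ matrices over $V$ and $Z$. $X$ is an *M-ideal* (resp. *complete M-ideal*) in $Y$ if $X^{**}$ is an M-summand (resp. complete M-summand) in $Y^{**}$. A projection $P$ is an *L-projection* (*M-projection*) if $\|x\|=\|Px\|+\|x-Px\|$ (resp. $\|x\|=\max\{\|Px\|,\|x-Px\|\}$) for all $x$. Operators $S_\alpha$ on a dual space converge to $S$ in the $W^*$-OT if $S_\alpha f\to Sf$ weak* for every $f$. $\mathcal K$ is the algebra of compact operators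 on $\ell^2$, and $\mathcal K\otimes_{op}E$ is the closure of the finitely supported infinite matrices over $E$ in the norm $\|\tau\|=\sup_n\|(\tau_{ij})_{i,j<n}\|$. The weak* topology on $\mathcal K\otimes_{op}Y^{**}\subset M_\infty(Y^{**})$ is the one given by the predual of $M_\infty(Y^{**})$, which consists of the products $a\,y\,b$ with $y\in\mathcal K\otimes_{op}Y^*$ and $a,b$ Hilbert–Schmidt. Let $(T_\alpha)$ be a net of bounded operators on $Y$. It is an *M-ai* (resp. *M-cai*) for $X$ in $Y$ if $\sup_\alpha\|T_\alpha\|<\infty$ and * (i) $T_\alpha Y\subset X$ for all $\alpha$; * (ii) $T_\alpha x\to x$ for all $x\in X$; * (iii) $\limsup_\alpha\|T_\alpha u+(I-T_\alpha)v\|\le\max\{\|u\|,\|v\|\}$ for all $u,v\in Y$; resp. (iii$'$) $\limsup_\alpha\|(T_\alpha u_{ij}+(I-T_\alpha)v_{ij})\|\le\max\{\|(u_{ij})\|,\|(v_{ij})\|\}$ for all $n$ and all $n\times n$ matrices $(u_{ij}),(v_{ij})$ over $Y$. It is *strong* if in addition (iv) $T_\alpha^{**}x^{**}\to x^{**}$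 weak* for all $x^{**}\in X^{**}$, and (v) $\limsup_\alpha\|T_\alpha^*y^*\|\le\|y^*\|$ for all $y^*\in Y^*$; resp. (v$'$) the $T_\alpha$ are completely bounded and $\limsup_\alpha\|(I_{\mathcal K}\otimes T_\alpha^*)\tau\|\le\|\tau\|$ for all $\tau\in\mathcal K\otimes_{op}Y^*$. It is a *weak contractive M-ai* (resp. *M-cai*) if the $T_\alpha$ are contractions (resp. complete contractions), (i) and (ii) hold, and (iii) (resp. (iii$'$)) holds with the $u$ (resp. all $u_{ij}$) restricted to $X$. **Theorem 1.1 (with Theorem 1.1′).** Suppose $(T_\alpha)$ is an M-ai or a weak contractive M-ai (resp. an M-cai or a weak contractive M-cai) for $X$ in $Y$. Then $X$ is an M-ideal (resp. complete M-ideal) in $Y$; there is a unique L-projection $P$ on $Y^*$ with kernel $X^\perp$; $T_\alpha^*\to P$ in the $W^*$-OT; and $P^*$ is an M-projection on $Y^{**}$ with range $X^{**}$. If moreover $(T_\alpha)$ is a strong M-ai (resp. strong M-cai), or is a weak contractive M-ai (resp. M-cai) satisfying (iv), then $T_\alpha^{**}\to P^*$ in the $W^*$-OT on $Y^{**}$;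 and in the operator space case $I_{\mathcal K}\otimes P^*$ maps $\mathcal K\otimes_{op}Y^{**}$ into itself and $I_{\mathcal K}\otimes T_\alpha^{**}\to I_{\mathcal K}\otimes P^*$ in the $W^*$-OT on $\mathcal K\otimes_{op}Y^{**}$. -/

import Mathlib

open Filter Topology
open scoped ENNReal

noncomputable section

section OperatorSpaces

open scoped Matrix.Norms.L2Operator

/-- The product `a x b` of scalar matrices `a`, `b` with a matrix `x` of vectors. -/
def sandwich {E : Type*} [AddCommGroup E] [Module ℂ E] {m n : ℕ}
    (a : Matrix (Fin n) (Fin m) ℂ) (x : Matrix (Fin m) (Fin m) E)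
    (b : Matrix (Fin m) (Fin n) ℂ) : Matrix (Fin n) (Fin n) E :=
  Matrix.of fun i j => ∑ k, ∑ l, (a i k * b l j) • x k l

/-- An operator space structure on a complex normed space: norms on all the spaces `M_n(E)`
subject to Ruan's axioms. Scalar matrices carry the norm of operators between Hilbert spaces.
(Definiteness of the norm on `M_n(E)`, and the reverse inequality in the direct sum axiom, follow
from the last axiom, by compressing to entries and to blocks.) -/
class OperatorSpace (E : Type*) [NormedAddCommGroup E] [NormedSpace ℂ E] where
  /-- the norm of `M_n(E)` -/
  mnorm : ∀ n : ℕ, Matrix (Fin n) (Fin n) E → ℝ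
  mnorm_add_le : ∀ {n : ℕ} (x y : Matrix (Fin n) (Fin n) E),
    mnorm n (x + y) ≤ mnorm n x + mnorm n y
  mnorm_smul : ∀ {n : ℕ} (c : ℂ) (x : Matrix (Fin n) (Fin n) E),
    mnorm n (c • x) = ‖c‖ * mnorm n x
  mnorm_one : ∀ v : E, mnorm 1 (Matrix.of fun _ _ => v) = ‖v‖
  mnorm_directSum_le : ∀ {m n : ℕ} (x : Matrix (Fin m) (Fin m) E) (y : Matrix (Fin n) (Fin n) E),
    mnorm (m + n) (Matrix.reindex finSumFinEquiv finSumFinEquiv (Matrix.fromBlocks x 0 0 y))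
      ≤ max (mnorm m x) (mnorm n y)
  mnorm_sandwich_le : ∀ {m n : ℕ} (a : Matrix (Fin n) (Fin m) ℂ) (x : Matrix (Fin m) (Fin m) E)
    (b : Matrix (Fin m) (Fin n) ℂ), mnorm n (sandwich a x b) ≤ ‖a‖ * mnorm m x * ‖b‖

/-- The norm of `M_n(E)`. -/
def mnorm {E : Type*} [NormedAddCommGroup E] [NormedSpace ℂ E] [OperatorSpace E] {n : ℕ}
    (x : Matrix (Fin n) (Fin n) E) : ℝ := OperatorSpace.mnorm n x

theorem mnorm_zero {E : Type*} [NormedAddCommGroup E] [NormedSpace ℂ E] [OperatorSpace E] {n : ℕ} :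
    mnorm (0 : Matrix (Fin n) (Fin n) E) = 0 := by
  have h := OperatorSpace.mnorm_smul 0 (0 : Matrix (Fin n) (Fin n) E)
  rw [zero_smul, norm_zero, zero_mul] at h
  exact h

theorem mnorm_nonneg {E : Type*} [NormedAddCommGroup E] [NormedSpace ℂ E] [OperatorSpace E] {n : ℕ}
    (x : Matrix (Fin n) (Fin n) E) : 0 ≤ mnorm x := by
  have h1 := OperatorSpace.mnorm_add_le x ((-1 : ℂ) • x)
  have h2 := OperatorSpace.mnorm_smul (-1 : ℂ) x
  have h3 : x + (-1 : ℂ) • x = 0 := by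
    ext i j
    simp
  have h4 : mnorm (0 : Matrix (Fin n) (Fin n) E) = 0 := mnorm_zero
  rw [h3, h2, norm_neg, norm_one, one_mul] at h1
  change mnorm (0 : Matrix (Fin n) (Fin n) E) ≤ mnorm x + mnorm x at h1
  linarith

/-! ### The dual operator space -/

section Scalar

variable {ι κ : Type*} [Fintype ι] [Fintype κ] [DecidableEq κ]

theorem l2_le_of_bilin (A : Matrix ι κ ℂ) {C : ℝ} (hC : 0 ≤ C)
    (h : ∀ (ξ : ι → ℂ) (η : κ → ℂ), ‖∑ p, ∑ q, ξ p * A p q * η q‖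
      ≤ C * ‖WithLp.toLp 2 ξ‖ * ‖WithLp.toLp 2 η‖) : ‖A‖ ≤ C := by
  rw [Matrix.l2_opNorm_def]
  refine ContinuousLinearMap.opNorm_le_bound _ hC fun η => ?_
  have h1 := h (fun p => star ((A.mulVec η.ofLp) p)) η.ofLp
  have e1 : ‖WithLp.toLp 2 (fun p => star ((A.mulVec η.ofLp) p))‖
      = ‖WithLp.toLp 2 (A.mulVec η.ofLp)‖ := by
    simp [EuclideanSpace.norm_eq]
  have e2 : ‖∑ p, ∑ q, star ((A.mulVec η.ofLp) p) * A p q * η.ofLp q‖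
      = ‖WithLp.toLp 2 (A.mulVec η.ofLp)‖ ^ 2 := by
    have : ∑ p, ∑ q, star ((A.mulVec η.ofLp) p) * A p q * η.ofLp q
        = ((∑ p, ‖(A.mulVec η.ofLp) p‖ ^ 2 : ℝ) : ℂ) := by
      push_cast
      refine Finset.sum_congr rfl fun p _ => ?_
      have : ∑ q, star ((A.mulVec η.ofLp) p) * A p q * η.ofLp q
          = star ((A.mulVec η.ofLp) p) * (A.mulVec η.ofLp) p := by
        conv_rhs => rw [Matrix.mulVec, dotProduct, Finset.mul_sum]
        simp [mul_assoc, Matrix.mulVec, dotProduct]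
      rw [this]
      exact Complex.conj_mul' _
    rw [this, EuclideanSpace.norm_sq_eq, Complex.norm_real, Real.norm_of_nonneg]
    positivity
  rw [e1, e2] at h1
  change ‖WithLp.toLp 2 (A.mulVec η.ofLp)‖ ≤ C * ‖η‖
  have h2 : WithLp.toLp 2 η.ofLp = η := rfl
  rw [h2] at h1
  rcases (norm_nonneg (WithLp.toLp 2 (A.mulVec η.ofLp))).eq_or_lt with h0 | h0
  · rw [← h0]; positivity
  · nlinarith

theorem bilin_le_l2 (A : Matrix ι κ ℂ) (ξ : ι → ℂ) (η : κ → ℂ) :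
    ‖∑ p, ∑ q, ξ p * A p q * η q‖ ≤ ‖A‖ * ‖WithLp.toLp 2 ξ‖ * ‖WithLp.toLp 2 η‖ := by
  have e : ∑ p, ∑ q, ξ p * A p q * η q
      = inner ℂ (WithLp.toLp 2 fun p => star (ξ p)) (WithLp.toLp 2 (A.mulVec η)) := by
    rw [PiLp.inner_apply]
    refine Finset.sum_congr rfl fun p _ => ?_
    simp [Matrix.mulVec, dotProduct, Finset.sum_mul]
    refine Finset.sum_congr rfl fun q _ => by ring
  rw [e]
  refine (norm_inner_le_norm _ _).trans ?_
  have h1 : ‖WithLp.toLp 2 (fun p => star (ξ p))‖ = ‖WithLp.toLp 2 ξ‖ := by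
    simp [EuclideanSpace.norm_eq]
  have h2 := Matrix.l2_opNorm_mulVec A (WithLp.toLp 2 η)
  rw [h1]
  have h3 : ‖WithLp.toLp 2 (A.mulVec η)‖ ≤ ‖A‖ * ‖WithLp.toLp 2 η‖ := h2
  nlinarith [norm_nonneg (WithLp.toLp 2 ξ)]

theorem norm_slice_le {ι κ : Type*} [Fintype ι] [Fintype κ] (ξ : ι × κ → ℂ) (i : ι) :
    ‖WithLp.toLp 2 (fun k => ξ (i, k))‖ ≤ ‖WithLp.toLp 2 ξ‖ := by
  rw [EuclideanSpace.norm_eq, EuclideanSpace.norm_eq]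
  refine Real.sqrt_le_sqrt ?_
  rw [Fintype.sum_prod_type]
  exact Finset.single_le_sum (f := fun i => ∑ k, ‖ξ (i, k)‖ ^ 2)
    (fun i _ => by positivity) (Finset.mem_univ i)

theorem sum_slice_mul_le {ι ι' κ : Type*} [Fintype ι] [Fintype ι'] [Fintype κ]
    (ξ : ι × κ → ℂ) (η : ι' × κ → ℂ) :
    ∑ k, ‖WithLp.toLp 2 (fun i => ξ (i, k))‖ * ‖WithLp.toLp 2 (fun i => η (i, k))‖
      ≤ ‖WithLp.toLp 2 ξ‖ * ‖WithLp.toLp 2 η‖ := by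
  refine (Real.sum_mul_le_sqrt_mul_sqrt _ _ _).trans (le_of_eq ?_)
  congr 1 <;>
  · rw [EuclideanSpace.norm_eq]
    congr 1
    rw [Fintype.sum_prod_type_right]
    exact Finset.sum_congr rfl fun k _ => EuclideanSpace.norm_sq_eq _

theorem kron_one_norm_le {n m r : ℕ} (a : Matrix (Fin n) (Fin m) ℂ) :
    ‖(Matrix.of fun (p : Fin n × Fin r) (q : Fin m × Fin r) =>
      if p.2 = q.2 then a p.1 q.1 else 0 : Matrix _ _ ℂ)‖ ≤ ‖a‖ := by
  refine l2_le_of_bilin _ (norm_nonneg _) fun ξ η => ?_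
  have e : ∑ p : Fin n × Fin r, ∑ q : Fin m × Fin r, ξ p *
      (Matrix.of fun (p : Fin n × Fin r) (q : Fin m × Fin r) =>
        if p.2 = q.2 then a p.1 q.1 else 0 : Matrix _ _ ℂ) p q * η q
      = ∑ k, ∑ i, ∑ j, ξ (i, k) * a i j * η (j, k) := by
    rw [Fintype.sum_prod_type_right]
    refine Finset.sum_congr rfl fun k _ => Finset.sum_congr rfl fun i _ => ?_
    rw [Fintype.sum_prod_type]
    refine Finset.sum_congr rfl fun j _ => ?_
    simp
  rw [e]
  calc _ ≤ ∑ k, ‖∑ i, ∑ j, ξ (i, k) * a i j * η (j, k)‖ := norm_sum_le _ _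
    _ ≤ ∑ k, ‖a‖ * (‖WithLp.toLp 2 (fun i => ξ (i, k))‖
          * ‖WithLp.toLp 2 (fun i => η (i, k))‖) := by
        refine Finset.sum_le_sum fun k _ => ?_
        rw [← mul_assoc]
        exact bilin_le_l2 a (fun i => ξ (i, k)) (fun j => η (j, k))
    _ ≤ _ := by
        rw [← Finset.mul_sum, mul_assoc]
        exact mul_le_mul_of_nonneg_left (sum_slice_mul_le ξ η) (norm_nonneg _)

end Scalar

variable {E : Type*} [NormedAddCommGroup E] [NormedSpace ℂ E]

/-- For `f ∈ M_n(E*)` and `y ∈ M_m(E)`, the scalar matrix `(f_{ij}(y_{kl}))` with rows indexed by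
`(i, k)` and columns indexed by `(j, l)`. -/
def pairMatrix {n m : ℕ} (f : Matrix (Fin n) (Fin n) (StrongDual ℂ E))
    (y : Matrix (Fin m) (Fin m) E) : Matrix (Fin n × Fin m) (Fin n × Fin m) ℂ :=
  Matrix.of fun p q => f p.1 q.1 (y p.2 q.2)

variable [OperatorSpace E]

theorem norm_sum_smul_le_mnorm {m : ℕ} (y : Matrix (Fin m) (Fin m) E) (ξ η : Fin m → ℂ) :
    ‖∑ k, ∑ l, (ξ k * η l) • y k l‖ ≤ mnorm y * ‖WithLp.toLp 2 ξ‖ * ‖WithLp.toLp 2 η‖ := by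
  have h := OperatorSpace.mnorm_sandwich_le (n := 1) (Matrix.of fun _ k => ξ k) y
    (Matrix.of fun l _ => η l)
  have e : sandwich (n := 1) (Matrix.of fun _ k => ξ k) y (Matrix.of fun l _ => η l)
      = Matrix.of fun _ _ => ∑ k, ∑ l, (ξ k * η l) • y k l := rfl
  rw [e, OperatorSpace.mnorm_one] at h
  have ha : ‖(Matrix.of fun _ k => ξ k : Matrix (Fin 1) (Fin m) ℂ)‖ ≤ ‖WithLp.toLp 2 ξ‖ := by
    refine l2_le_of_bilin _ (norm_nonneg _) fun u v => ?_
    have e1 : ‖WithLp.toLp 2 u‖ = ‖u 0‖ := by simp [EuclideanSpace.norm_eq]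
    have e2 : ∑ p : Fin 1, ∑ q, u p * (Matrix.of fun _ k => ξ k : Matrix (Fin 1) (Fin m) ℂ) p q
        * v q = u 0 * inner ℂ (WithLp.toLp 2 fun k => star (ξ k)) (WithLp.toLp 2 v) := by
      simp [PiLp.inner_apply, Finset.mul_sum]
      exact Finset.sum_congr rfl fun q _ => by ring
    have h1 : ‖WithLp.toLp 2 (fun p => star (ξ p))‖ = ‖WithLp.toLp 2 ξ‖ := by
      simp [EuclideanSpace.norm_eq]
    have h2 := norm_inner_le_norm (𝕜 := ℂ) (WithLp.toLp 2 fun k => star (ξ k)) (WithLp.toLp 2 v)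
    rw [h1] at h2
    rw [e1, e2, norm_mul]
    nlinarith [norm_nonneg (u 0)]
  have hb : ‖(Matrix.of fun l _ => η l : Matrix (Fin m) (Fin 1) ℂ)‖ ≤ ‖WithLp.toLp 2 η‖ := by
    refine l2_le_of_bilin _ (norm_nonneg _) fun u v => ?_
    have e1 : ‖WithLp.toLp 2 v‖ = ‖v 0‖ := by simp [EuclideanSpace.norm_eq]
    have e2 : ∑ p, ∑ q : Fin 1, u p * (Matrix.of fun l _ => η l : Matrix (Fin m) (Fin 1) ℂ) p q
        * v q = inner ℂ (WithLp.toLp 2 fun k => star (u k)) (WithLp.toLp 2 η) * v 0 := by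
      simp [PiLp.inner_apply, Finset.sum_mul]
      exact Finset.sum_congr rfl fun q _ => by ring
    have h1 : ‖WithLp.toLp 2 (fun p => star (u p))‖ = ‖WithLp.toLp 2 u‖ := by
      simp [EuclideanSpace.norm_eq]
    have h2 := norm_inner_le_norm (𝕜 := ℂ) (WithLp.toLp 2 fun k => star (u k)) (WithLp.toLp 2 η)
    rw [h1] at h2
    rw [e1, e2, norm_mul]
    nlinarith [norm_nonneg (v 0)]
  have hy : 0 ≤ mnorm y := mnorm_nonneg _
  calc _ ≤ _ := h
    _ ≤ ‖WithLp.toLp 2 ξ‖ * mnorm y * ‖WithLp.toLp 2 η‖ := by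
        change _ * mnorm y * _ ≤ _
        gcongr
    _ = _ := by ring

theorem norm_pairMatrix_le_sum {n m : ℕ} (f : Matrix (Fin n) (Fin n) (StrongDual ℂ E))
    (y : Matrix (Fin m) (Fin m) E) (hy : mnorm y ≤ 1) :
    ‖pairMatrix f y‖ ≤ ∑ i, ∑ j, ‖f i j‖ := by
  refine l2_le_of_bilin _ (by positivity) fun ξ η => ?_
  have e : ∑ p, ∑ q, ξ p * pairMatrix f y p q * η q
      = ∑ i, ∑ j, f i j (∑ k, ∑ l, (ξ (i, k) * η (j, l)) • y k l) := by
    rw [Fintype.sum_prod_type]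
    refine Finset.sum_congr rfl fun i _ => ?_
    simp_rw [Fintype.sum_prod_type]
    rw [Finset.sum_comm]
    refine Finset.sum_congr rfl fun j _ => ?_
    simp only [map_sum, map_smul, smul_eq_mul, pairMatrix, Matrix.of_apply]
    exact Finset.sum_congr rfl fun k _ => Finset.sum_congr rfl fun l _ => by ring
  rw [e, Finset.sum_mul, Finset.sum_mul]
  refine (norm_sum_le _ _).trans (Finset.sum_le_sum fun i _ => ?_)
  rw [Finset.sum_mul, Finset.sum_mul]
  refine (norm_sum_le _ _).trans (Finset.sum_le_sum fun j _ => ?_)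
  refine ((f i j).le_opNorm _).trans ?_
  rw [mul_assoc]
  refine mul_le_mul_of_nonneg_left ?_ (norm_nonneg _)
  have hy0 : 0 ≤ mnorm y := mnorm_nonneg _
  calc _ ≤ _ := norm_sum_smul_le_mnorm y (fun k => ξ (i, k)) (fun l => η (j, l))
    _ ≤ 1 * ‖WithLp.toLp 2 ξ‖ * ‖WithLp.toLp 2 η‖ := by
        gcongr
        · exact norm_slice_le ξ i
        · exact norm_slice_le η j
    _ = _ := by ring

/-- The closed unit balls of all the matrix spaces `M_m(E)`. -/
abbrev MatrixBall (E : Type*) [NormedAddCommGroup E] [NormedSpace ℂ E] [OperatorSpace E] :=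
  {y : Σ m : ℕ, Matrix (Fin m) (Fin m) E // mnorm y.2 ≤ 1}

instance : Nonempty (MatrixBall E) := ⟨⟨⟨0, 0⟩, by simp [mnorm_zero]⟩⟩

/-- The norm of `f ∈ M_n(E*)` as a completely bounded map `E → M_n`: the supremum of
`‖(f_{ij}(y_{kl}))‖` over all `m` and all `y` in the unit ball of `M_m(E)`. -/
def dualMnorm {n : ℕ} (f : Matrix (Fin n) (Fin n) (StrongDual ℂ E)) : ℝ :=
  ⨆ y : MatrixBall E, ‖pairMatrix f y.1.2‖

theorem bddAbove_dualMnorm {n : ℕ} (f : Matrix (Fin n) (Fin n) (StrongDual ℂ E)) :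
    BddAbove (Set.range fun y : MatrixBall E => ‖pairMatrix f y.1.2‖) :=
  ⟨∑ i, ∑ j, ‖f i j‖, by rintro _ ⟨y, rfl⟩; exact norm_pairMatrix_le_sum f _ y.2⟩

theorem norm_pairMatrix_le {n m : ℕ} (f : Matrix (Fin n) (Fin n) (StrongDual ℂ E))
    (y : Matrix (Fin m) (Fin m) E) (hy : mnorm y ≤ 1) : ‖pairMatrix f y‖ ≤ dualMnorm f :=
  le_ciSup (bddAbove_dualMnorm f) ⟨⟨m, y⟩, hy⟩

theorem dualMnorm_nonneg {n : ℕ} (f : Matrix (Fin n) (Fin n) (StrongDual ℂ E)) :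
    0 ≤ dualMnorm f := Real.iSup_nonneg fun _ => norm_nonneg _

theorem dualMnorm_one (f : StrongDual ℂ E) :
    dualMnorm (n := 1) (Matrix.of fun _ _ => f) = ‖f‖ := by
  apply le_antisymm
  · refine ciSup_le fun y => ?_
    simpa using norm_pairMatrix_le_sum (n := 1) (Matrix.of fun _ _ => f) _ y.2
  · have key : ∀ v : E, ‖v‖ ≤ 1 → ‖f v‖ ≤ dualMnorm (n := 1) (Matrix.of fun _ _ => f) := by
      intro v hv
      have hy : mnorm (n := 1) (Matrix.of fun _ _ => v) ≤ 1 := by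
        rw [mnorm, OperatorSpace.mnorm_one]; exact hv
      refine le_trans ?_ (norm_pairMatrix_le (n := 1) (Matrix.of fun _ _ => f) _ hy)
      have := bilin_le_l2 (pairMatrix (n := 1) (m := 1) (Matrix.of fun _ _ => f)
        (Matrix.of fun _ _ => v)) (fun _ => 1) (fun _ => 1)
      simpa [EuclideanSpace.norm_eq, pairMatrix, Fintype.sum_prod_type] using this
    exact f.opNorm_le_of_unit_norm (𝕜 := ℂ) (dualMnorm_nonneg _) fun v hv => key v hv.le

theorem dualMnorm_directSum_le {m n : ℕ} (f : Matrix (Fin m) (Fin m) (StrongDual ℂ E))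
    (g : Matrix (Fin n) (Fin n) (StrongDual ℂ E)) :
    dualMnorm (Matrix.reindex finSumFinEquiv finSumFinEquiv (Matrix.fromBlocks f 0 0 g))
      ≤ max (dualMnorm f) (dualMnorm g) := by
  refine ciSup_le fun y => ?_
  obtain ⟨⟨r, y⟩, hy⟩ := y
  refine l2_le_of_bilin _ ((dualMnorm_nonneg f).trans (le_max_left _ _)) fun ξ η => ?_
  set M := max (dualMnorm f) (dualMnorm g) with hM
  set ξ₁ : Fin m × Fin r → ℂ := fun p => ξ (Fin.castAdd n p.1, p.2)
  set ξ₂ : Fin n × Fin r → ℂ := fun p => ξ (Fin.natAdd m p.1, p.2)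
  set η₁ : Fin m × Fin r → ℂ := fun p => η (Fin.castAdd n p.1, p.2)
  set η₂ : Fin n × Fin r → ℂ := fun p => η (Fin.natAdd m p.1, p.2)
  have e : ∑ p, ∑ q, ξ p * pairMatrix (Matrix.reindex finSumFinEquiv finSumFinEquiv
        (Matrix.fromBlocks f 0 0 g)) y p q * η q
      = (∑ p, ∑ q, ξ₁ p * pairMatrix f y p q * η₁ q)
        + ∑ p, ∑ q, ξ₂ p * pairMatrix g y p q * η₂ q := by
    simp only [Fintype.sum_prod_type, Fin.sum_univ_add, pairMatrix, Matrix.of_apply,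
      Matrix.reindex_apply, Matrix.submatrix_apply, finSumFinEquiv_symm_apply_castAdd,
      finSumFinEquiv_symm_apply_natAdd, Matrix.fromBlocks_apply₁₁, Matrix.fromBlocks_apply₁₂,
      Matrix.fromBlocks_apply₂₁, Matrix.fromBlocks_apply₂₂, Matrix.zero_apply,
      _root_.zero_apply, mul_zero, zero_mul, Finset.sum_const_zero, add_zero,
      zero_add, ξ₁, ξ₂, η₁, η₂]
  have hs : ∀ ζ : Fin (m + n) × Fin r → ℂ, ‖WithLp.toLp 2 ζ‖ ^ 2
      = ‖WithLp.toLp 2 (fun p : Fin m × Fin r => ζ (Fin.castAdd n p.1, p.2))‖ ^ 2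
        + ‖WithLp.toLp 2 (fun p : Fin n × Fin r => ζ (Fin.natAdd m p.1, p.2))‖ ^ 2 := by
    intro ζ
    simp only [EuclideanSpace.norm_sq_eq, Fintype.sum_prod_type, Fin.sum_univ_add]
  have h1 := (bilin_le_l2 (pairMatrix f y) ξ₁ η₁)
  have h2 := (bilin_le_l2 (pairMatrix g y) ξ₂ η₂)
  have hf : ‖pairMatrix f y‖ ≤ M := (norm_pairMatrix_le f y hy).trans (le_max_left _ _)
  have hg : ‖pairMatrix g y‖ ≤ M := (norm_pairMatrix_le g y hy).trans (le_max_right _ _)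
  have hM0 : 0 ≤ M := (norm_nonneg _).trans hf
  have hx := hs ξ
  have hη := hs η
  change _ = ‖WithLp.toLp 2 ξ₁‖ ^ 2 + ‖WithLp.toLp 2 ξ₂‖ ^ 2 at hx
  change _ = ‖WithLp.toLp 2 η₁‖ ^ 2 + ‖WithLp.toLp 2 η₂‖ ^ 2 at hη
  have cs : ‖WithLp.toLp 2 ξ₁‖ * ‖WithLp.toLp 2 η₁‖ + ‖WithLp.toLp 2 ξ₂‖ * ‖WithLp.toLp 2 η₂‖
      ≤ ‖WithLp.toLp 2 ξ‖ * ‖WithLp.toLp 2 η‖ := by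
    refine abs_le_of_sq_le_sq' ?_ (by positivity) |>.2
    rw [mul_pow, hx, hη]
    nlinarith [sq_nonneg (‖WithLp.toLp 2 ξ₁‖ * ‖WithLp.toLp 2 η₂‖
      - ‖WithLp.toLp 2 ξ₂‖ * ‖WithLp.toLp 2 η₁‖)]
  rw [e]
  calc _ ≤ _ := norm_add_le _ _
    _ ≤ M * ‖WithLp.toLp 2 ξ₁‖ * ‖WithLp.toLp 2 η₁‖
        + M * ‖WithLp.toLp 2 ξ₂‖ * ‖WithLp.toLp 2 η₂‖ := by
        refine add_le_add (h1.trans ?_) (h2.trans ?_) <;> gcongr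
    _ = M * (‖WithLp.toLp 2 ξ₁‖ * ‖WithLp.toLp 2 η₁‖
        + ‖WithLp.toLp 2 ξ₂‖ * ‖WithLp.toLp 2 η₂‖) := by ring
    _ ≤ M * (‖WithLp.toLp 2 ξ‖ * ‖WithLp.toLp 2 η‖) := mul_le_mul_of_nonneg_left cs hM0
    _ = _ := by ring

theorem dualMnorm_sandwich_le {m n : ℕ} (a : Matrix (Fin n) (Fin m) ℂ)
    (f : Matrix (Fin m) (Fin m) (StrongDual ℂ E)) (b : Matrix (Fin m) (Fin n) ℂ) :
    dualMnorm (sandwich a f b) ≤ ‖a‖ * dualMnorm f * ‖b‖ := by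
  refine ciSup_le fun y => ?_
  obtain ⟨⟨r, y⟩, hy⟩ := y
  set a' : Matrix (Fin n × Fin r) (Fin m × Fin r) ℂ :=
    Matrix.of fun p q => if p.2 = q.2 then a p.1 q.1 else 0
  set b' : Matrix (Fin m × Fin r) (Fin n × Fin r) ℂ :=
    Matrix.of fun p q => if p.2 = q.2 then b p.1 q.1 else 0
  have e : pairMatrix (sandwich a f b) y = a' * pairMatrix f y * b' := by
    ext ⟨i, k⟩ ⟨j, l⟩
    simp only [pairMatrix, sandwich, Matrix.of_apply, Matrix.mul_apply, Fintype.sum_prod_type,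
      a', b', ite_mul, zero_mul, mul_ite, mul_zero, Finset.sum_ite_eq, Finset.sum_ite_eq',
      Finset.mem_univ, if_true, _root_.sum_apply, _root_.smul_apply,
      smul_eq_mul]
    rw [Finset.sum_comm]
    refine Finset.sum_congr rfl fun i' _ => ?_
    rw [Finset.sum_mul]
    exact Finset.sum_congr rfl fun j' _ => by ring
  rw [e]
  have h1 : ‖a'‖ ≤ ‖a‖ := kron_one_norm_le a
  have h2 : ‖b'‖ ≤ ‖b‖ := kron_one_norm_le b
  have h3 := norm_pairMatrix_le f y hy
  calc _ ≤ ‖a' * pairMatrix f y‖ * ‖b'‖ := Matrix.l2_opNorm_mul _ _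
    _ ≤ ‖a'‖ * ‖pairMatrix f y‖ * ‖b'‖ := by gcongr; exact Matrix.l2_opNorm_mul _ _
    _ ≤ _ := by
        have := dualMnorm_nonneg f
        gcongr

theorem dualMnorm_add_le {n : ℕ} (f g : Matrix (Fin n) (Fin n) (StrongDual ℂ E)) :
    dualMnorm (f + g) ≤ dualMnorm f + dualMnorm g := by
  refine ciSup_le fun y => ?_
  have : pairMatrix (f + g) y.1.2 = pairMatrix f y.1.2 + pairMatrix g y.1.2 := rfl
  rw [this]
  exact (norm_add_le _ _).trans
    (add_le_add (norm_pairMatrix_le f _ y.2) (norm_pairMatrix_le g _ y.2))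

theorem dualMnorm_smul {n : ℕ} (c : ℂ) (f : Matrix (Fin n) (Fin n) (StrongDual ℂ E)) :
    dualMnorm (c • f) = ‖c‖ * dualMnorm f := by
  have : ∀ y : MatrixBall E, ‖pairMatrix (c • f) y.1.2‖ = ‖c‖ * ‖pairMatrix f y.1.2‖ := by
    intro y
    have h : pairMatrix (c • f) y.1.2 = c • pairMatrix f y.1.2 := rfl
    rw [h, norm_smul]
  rw [dualMnorm, dualMnorm, Real.mul_iSup_of_nonneg (norm_nonneg c)]
  exact iSup_congr this

/-- The standard operator space structure of the dual, `M_n(E*) = CB(E, M_n)`. -/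
instance StrongDual.instOperatorSpace : OperatorSpace (StrongDual ℂ E) where
  mnorm _ := dualMnorm
  mnorm_add_le := dualMnorm_add_le
  mnorm_smul := dualMnorm_smul
  mnorm_one := dualMnorm_one
  mnorm_directSum_le := dualMnorm_directSum_le
  mnorm_sandwich_le := dualMnorm_sandwich_le

end OperatorSpaces

/-! ### Annihilators, adjoints, weak* operator convergence -/

section Banach

variable {𝕜 : Type*} [RCLike 𝕜] {E : Type*} [NormedAddCommGroup E] [NormedSpace 𝕜 E]

/-- The annihilator `X^⊥ ⊆ E*` of a subspace `X ⊆ E`. -/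
def annihilatorDual (X : Submodule 𝕜 E) : Submodule 𝕜 (StrongDual 𝕜 E) where
  carrier := {f | ∀ x ∈ X, f x = 0}
  add_mem' hf hg x hx := by simp [hf x hx, hg x hx]
  zero_mem' _ _ := rfl
  smul_mem' c f hf x hx := by simp [hf x hx]

/-- `X^⊥⊥ ⊆ E**`, the canonical copy of `X**` in `E**`. -/
abbrev biannihilator (X : Submodule 𝕜 E) : Submodule 𝕜 (StrongDual 𝕜 (StrongDual 𝕜 E)) :=
  annihilatorDual (annihilatorDual X)

/-- The Banach space adjoint `T* : E* → E*`, `T* f = f ∘ T`. -/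
def dualOp (T : E →L[𝕜] E) : StrongDual 𝕜 E →L[𝕜] StrongDual 𝕜 E :=
  (ContinuousLinearMap.compL 𝕜 E E 𝕜).flip T

/-- Convergence `S_i → S` in the weak* operator topology for operators on `E*`. -/
def TendstoWStarOT {ι : Type*} (S : ι → StrongDual 𝕜 E →L[𝕜] StrongDual 𝕜 E) (l : Filter ι)
    (S₀ : StrongDual 𝕜 E →L[𝕜] StrongDual 𝕜 E) : Prop :=
  ∀ f : StrongDual 𝕜 E, Tendsto (fun i => StrongDual.toWeakDual (S i f)) l
    (𝓝 (StrongDual.toWeakDual (S₀ f)))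

/-! ### M-ideals and M-approximate identities -/

/-- `X` is an M-summand of `E`. -/
def IsMSummand (X : Submodule 𝕜 E) : Prop :=
  ∃ Z : Submodule 𝕜 E, IsClosed (Z : Set E) ∧ IsCompl X Z ∧
    ∀ x ∈ X, ∀ z ∈ Z, ‖x + z‖ = max ‖x‖ ‖z‖

/-- `X` is an M-ideal of `E`: `X** = X^⊥⊥` is an M-summand of `E**`. -/
def IsMIdeal (X : Submodule 𝕜 E) : Prop :=
  IsMSummand (𝕜 := 𝕜) (E := StrongDual 𝕜 (StrongDual 𝕜 E)) (biannihilator X)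

variable {ι : Type*} [Preorder ι]

/-- `(T_α)` is an M-approximate identity for `X` in `E`. -/
structure IsMai (X : Submodule 𝕜 E) (T : ι → E →L[𝕜] E) : Prop where
  bounded : ∃ C : ℝ, ∀ α, ‖T α‖ ≤ C
  mem : ∀ α y, T α y ∈ X
  tendsto : ∀ x ∈ X, Tendsto (fun α => T α x) atTop (𝓝 x)
  limsup_le : ∀ u v : E, limsup (fun α => ‖T α u + (v - T α v)‖ₑ) atTop ≤ max ‖u‖ₑ ‖v‖ₑ

/-- `T_α** x** → x**` weak* for all `x** ∈ X** = X^⊥⊥`. -/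
def BidualTendsto (X : Submodule 𝕜 E) (T : ι → E →L[𝕜] E) : Prop :=
  ∀ x ∈ biannihilator X, Tendsto (fun α => StrongDual.toWeakDual (dualOp (dualOp (T α)) x)) atTop
    (𝓝 (StrongDual.toWeakDual x))

/-- `(T_α)` is a strong M-approximate identity for `X` in `E`. -/
structure IsStrongMai (X : Submodule 𝕜 E) (T : ι → E →L[𝕜] E) : Prop extends IsMai X T where
  bidual : BidualTendsto X T
  limsup_dual_le : ∀ f : StrongDual 𝕜 E, limsup (fun α => ‖dualOp (T α) f‖ₑ) atTop ≤ ‖f‖ₑ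

/-- `(T_α)` is a weak contractive M-approximate identity for `X` in `E`. -/
structure IsWeakContractiveMai (X : Submodule 𝕜 E) (T : ι → E →L[𝕜] E) : Prop where
  contractive : ∀ α, ‖T α‖ ≤ 1
  mem : ∀ α y, T α y ∈ X
  tendsto : ∀ x ∈ X, Tendsto (fun α => T α x) atTop (𝓝 x)
  limsup_le : ∀ u ∈ X, ∀ v : E,
    limsup (fun α => ‖T α u + (v - T α v)‖ₑ) atTop ≤ max ‖u‖ₑ ‖v‖ₑ

end Banach

/-! ### Complete M-ideals and M-complete approximate identities -/

section Complete

variable {E : Type*} [NormedAddCommGroup E] [NormedSpace ℂ E] [OperatorSpace E]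

/-- `X` is a complete M-summand of `E`. -/
def IsCompleteMSummand (X : Submodule ℂ E) : Prop :=
  ∃ Z : Submodule ℂ E, IsClosed (Z : Set E) ∧ IsCompl X Z ∧
    ∀ (n : ℕ) (x z : Matrix (Fin n) (Fin n) E), (∀ i j, x i j ∈ X) → (∀ i j, z i j ∈ Z) →
      mnorm (x + z) = max (mnorm x) (mnorm z)

/-- `X` is a complete M-ideal of `E`: `X** = X^⊥⊥` is a complete M-summand of `E**`. -/
def IsCompleteMIdeal (X : Submodule ℂ E) : Prop :=
  IsCompleteMSummand (E := StrongDual ℂ (StrongDual ℂ E)) (biannihilator X)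

/-- The norm (possibly infinite) of an infinite matrix over `E`, as an element of `M_∞(E)`. -/
def infMnorm (τ : Matrix ℕ ℕ E) : ℝ≥0∞ :=
  ⨆ n : ℕ, ENNReal.ofReal (mnorm (Matrix.of fun i j : Fin n => τ i j))

/-- The upper left `n × n` corner of an infinite matrix, padded with zeros. -/
def corner (n : ℕ) (τ : Matrix ℕ ℕ E) : Matrix ℕ ℕ E :=
  Matrix.of fun i j => if i < n ∧ j < n then τ i j else 0

/-- Membership in `𝒦 ⊗_op E`, where `𝒦` is the algebra of compact operators on `ℓ²`: the infinite
matrices over `E` which are limits, in the norm of `M_∞(E)`, of their finite corners, i.e. the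
norm closure of the finitely supported matrices. In this description `e_{ij} ⊗ v` is the matrix
with only entry `v` at `(i, j)`, and `I_𝒦 ⊗ T` is the entrywise application of `T`. -/
def MemCompactTensor (τ : Matrix ℕ ℕ E) : Prop :=
  Tendsto (fun n => infMnorm (τ - corner n τ)) atTop (𝓝 0)

/-- The duality between `M_∞(E*)` (which contains `𝒦 ⊗_op E*`) and its predual, the trace class
matrices over `E`. The elements of the predual are the products `a y b` with `a`, `b`
Hilbert-Schmidt matrices and `y ∈ 𝒦 ⊗_op E`, and
`⟨μ, a y b⟩ = ∑ a_{ik} μ_{ij}(y_{kl}) b_{lj}`. Here `a p` with `p = (i, k)` is `a_{ik}`,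
`b q` with `q = (j, l)` is `b_{lj}`, and the sum is that of the bounded operator on `ℓ²(ℕ × ℕ)`
with matrix `(μ_{ij}(y_{kl}))` applied to `b` and then paired with `a`. -/
def compactPairing (μ : Matrix ℕ ℕ (StrongDual ℂ E)) (y : Matrix ℕ ℕ E)
    (a b : lp (fun _ : ℕ × ℕ => ℂ) 2) : ℂ :=
  ∑' p : ℕ × ℕ, a p * ∑' q : ℕ × ℕ, μ p.1 q.1 (y p.2 q.2) * b q

/-- Convergence `I_𝒦 ⊗ S_i → I_𝒦 ⊗ S` in the weak* operator topology on `𝒦 ⊗_op E*`. -/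
def CompactTendstoWStarOT {ι : Type*} (S : ι → StrongDual ℂ E →L[ℂ] StrongDual ℂ E)
    (l : Filter ι) (S₀ : StrongDual ℂ E →L[ℂ] StrongDual ℂ E) : Prop :=
  ∀ μ : Matrix ℕ ℕ (StrongDual ℂ E), MemCompactTensor μ →
    ∀ y : Matrix ℕ ℕ E, MemCompactTensor y → ∀ a b : lp (fun _ : ℕ × ℕ => ℂ) 2,
      Tendsto (fun i => compactPairing (μ.map (S i)) y a b) l
        (𝓝 (compactPairing (μ.map S₀) y a b))

variable {ι : Type*} [Preorder ι]

/-- `(T_α)` is an M-complete approximate identity for `X` in `E`. -/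
structure IsMcai (X : Submodule ℂ E) (T : ι → E →L[ℂ] E) : Prop where
  bounded : ∃ C : ℝ, ∀ α, ‖T α‖ ≤ C
  mem : ∀ α y, T α y ∈ X
  tendsto : ∀ x ∈ X, Tendsto (fun α => T α x) atTop (𝓝 x)
  limsup_le : ∀ (n : ℕ) (u v : Matrix (Fin n) (Fin n) E),
    limsup (fun α => ENNReal.ofReal (mnorm (u.map (T α) + (v - v.map (T α))))) atTop
      ≤ ENNReal.ofReal (max (mnorm u) (mnorm v))

/-- `(T_α)` is a strong M-complete approximate identity for `X` in `E`. -/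
structure IsStrongMcai (X : Submodule ℂ E) (T : ι → E →L[ℂ] E) : Prop extends IsMcai X T where
  bidual : BidualTendsto X T
  completelyBounded : ∀ α, ∃ C : ℝ, ∀ (n : ℕ) (x : Matrix (Fin n) (Fin n) E),
    mnorm (x.map (T α)) ≤ C * mnorm x
  limsup_dual_le : ∀ τ : Matrix ℕ ℕ (StrongDual ℂ E), MemCompactTensor τ →
    limsup (fun α => infMnorm (τ.map (dualOp (T α)))) atTop ≤ infMnorm τ

/-- `(T_α)` is a weak contractive M-complete approximate identity for `X` in `E`. -/
structure IsWeakContractiveMcai (X : Submodule ℂ E) (T : ι → E →L[ℂ] E) : Prop where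
  completelyContractive : ∀ α (n : ℕ) (x : Matrix (Fin n) (Fin n) E),
    mnorm (x.map (T α)) ≤ mnorm x
  mem : ∀ α y, T α y ∈ X
  tendsto : ∀ x ∈ X, Tendsto (fun α => T α x) atTop (𝓝 x)
  limsup_le : ∀ (n : ℕ) (u v : Matrix (Fin n) (Fin n) E), (∀ i j, u i j ∈ X) →
    limsup (fun α => ENNReal.ofReal (mnorm (u.map (T α) + (v - v.map (T α))))) atTop
      ≤ ENNReal.ofReal (max (mnorm u) (mnorm v))

end Complete

end

/-!
### Approximate identities, `L`-projections and M-ideals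

Bounded sets of operators on `Y*` are relatively compact in the weak* operator topology. If `P` is
a cluster point of `(T_α*)`, then `P` vanishes on `X^⊥` because `T_α Y ⊆ X`, and `f - P f ∈ X^⊥`
because `T_α x → x` on `X`; so `P` is a projection with kernel `X^⊥`. Evaluating `f` at
`T_α u + (v - T_α v)` and passing to the limit in the hypothesis `limsup_le` gives
`|P f (u) + (f - P f) (v)| ≤ ‖f‖ max(‖u‖, ‖v‖)`, which says that `P` is an `L`-projection. Two
`L`-projections commute, so they coincide if their kernels do; hence there is only one cluster point
and the net converges (`exists_isLprojection_tendsto`). Then `P*` is an `M`-projection with range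
`X^⊥⊥`, which is the M-ideal property. For the biadjoints, only functionals `F` with `F ∘ P = 0`
need an argument: see `tendsto_dualOp_zero`.

For operator spaces the same estimate holds for functionals `φ` on `M_n(Y)`
(`IsMatricialLContraction`). To make `X^⊥⊥` a complete M-summand it must be carried over to
`M_n(Y**)`, whose norm is that of `CB(Y*, M_n)`. This is the one substantial ingredient:
a functional of norm one on `M_n(Y)` keeps its norm on `M_n(Y**)` (`norm_matrixPairing_bidual_le`).
By the Hahn-Banach theorem and Ruan's axioms it factors as `Bᵀ f C` with `f` in the unit ball of
`M_n(Y*)` and `B`, `C` Hilbert-Schmidt matrices of norm close to one (`exists_factorization`).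
Applied to block diagonal matrices, this yields `‖F + G‖ ≤ max(‖F‖, ‖G‖)`.

Finally, convergence of `I_𝒦 ⊗ T_α**` reduces to that of `T_α**`: the matrices
`(μ_{ij}(T_α* y_{kl}))` converge entrywise and are eventually uniformly bounded on `ℓ²`, so that the
associated forms converge (`tendsto_form_of_isSectionBounded`).
-/

/-! ### Limits of the adjoints -/

/-- The limit of a net is bounded as the upper limit of a net of real numbers dominating it. The
second net is allowed to be controlled along `l'` while the limit is taken along a finer `l`. -/
theorem norm_le_of_limsup_ofReal_le {ι F : Type*} [SeminormedAddCommGroup F] {l l' : Filter ι}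
    [NeBot l] (hl : l ≤ l') {z : ι → F} {z₀ : F} {N : ι → ℝ} {c M : ℝ} (hc : 0 ≤ c) (hM : 0 ≤ M)
    (hz : Tendsto z l (𝓝 z₀))
    (hN : limsup (fun i => ENNReal.ofReal (N i)) l' ≤ ENNReal.ofReal M)
    (h : ∀ i, ‖z i‖ ≤ c * N i) : ‖z₀‖ ≤ c * M := by
  have key : ∀ δ : ℝ, 0 < δ → ‖z₀‖ ≤ c * (M + δ) := by
    intro δ hδ
    have h1 : limsup (fun i => ENNReal.ofReal (N i)) l' < ENNReal.ofReal (M + δ) :=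
      hN.trans_lt ((ENNReal.ofReal_lt_ofReal_iff (by linarith)).2 (by linarith))
    have h2 := hl (eventually_lt_of_limsup_lt h1)
    refine le_of_tendsto hz.norm ?_
    filter_upwards [h2] with i hi
    refine (h i).trans (mul_le_mul_of_nonneg_left ?_ hc)
    exact ((ENNReal.ofReal_lt_ofReal_iff (by linarith)).1 hi).le
  have h3 : Tendsto (fun δ : ℝ => c * (M + δ)) (𝓝[>] 0) (𝓝 (c * (M + 0))) := by
    refine Tendsto.mono_left ?_ nhdsWithin_le_nhds
    exact (by fun_prop : Continuous fun δ : ℝ => c * (M + δ)).tendsto 0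
  rw [add_zero] at h3
  exact ge_of_tendsto h3 (eventually_nhdsWithin_of_forall fun δ hδ => key δ hδ)

section Banach

variable {𝕜 : Type*} [RCLike 𝕜] {E : Type*} [NormedAddCommGroup E] [NormedSpace 𝕜 E]
  {ι : Type*} {X : Submodule 𝕜 E} {T : ι → E →L[𝕜] E} {l : Filter ι}
  {P : StrongDual 𝕜 E →L[𝕜] StrongDual 𝕜 E}

theorem dualOp_apply (T : E →L[𝕜] E) (f : StrongDual 𝕜 E) (y : E) : dualOp T f y = f (T y) := rfl

theorem norm_dualOp_apply_le {T : E →L[𝕜] E} (hT : ‖T‖ ≤ 1) (f : StrongDual 𝕜 E) :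
    ‖dualOp T f‖ ≤ ‖f‖ :=
  (f.opNorm_comp_le T).trans (mul_le_of_le_one_right (norm_nonneg _) hT)

theorem tendstoWStarOT_iff {S : ι → StrongDual 𝕜 E →L[𝕜] StrongDual 𝕜 E} :
    TendstoWStarOT S l P ↔ ∀ f y, Tendsto (fun i => S i f y) l (𝓝 (P f y)) :=
  forall_congr' fun _ => tendsto_iff_forall_eval_tendsto_topDualPairing

/-- Bounded sets of operators on a dual space are relatively compact in the weak* operator
topology. -/
theorem exists_tendstoWStarOT_ultrafilter {S : ι → StrongDual 𝕜 E →L[𝕜] StrongDual 𝕜 E}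
    (hb : ∃ C : ℝ, ∀ i, ‖S i‖ ≤ C) (U : Ultrafilter ι) : ∃ P, TendstoWStarOT S U P := by
  obtain ⟨C, hC⟩ := hb
  have hbd : ∀ i f y, ‖S i f y‖ ≤ C * ‖f‖ * ‖y‖ := fun i f y =>
    ((S i).le_opNorm₂ f y).trans (by gcongr; exact hC i)
  have hlim : ∀ f y, ∃ c : 𝕜, Tendsto (fun i => S i f y) U (𝓝 c) := by
    intro f y
    obtain ⟨c, -, hc⟩ := (isCompact_closedBall (0 : 𝕜) (C * ‖f‖ * ‖y‖)).ultrafilter_le_nhds'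
      (U.map fun i => S i f y)
      (Ultrafilter.mem_map.2 (by filter_upwards with i; simpa using hbd i f y))
    exact ⟨c, hc⟩
  choose L hL using hlim
  refine ⟨LinearMap.mkContinuous₂ (LinearMap.mk₂ 𝕜 L ?_ ?_ ?_ ?_) C ?_,
    tendstoWStarOT_iff.2 hL⟩
  · intro f g y
    refine tendsto_nhds_unique (hL (f + g) y) ?_
    simpa using (hL f y).add (hL g y)
  · intro c f y
    refine tendsto_nhds_unique (hL (c • f) y) ?_
    simpa using (hL f y).const_mul c
  · intro f y z
    refine tendsto_nhds_unique (hL f (y + z)) ?_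
    simpa using (hL f y).add (hL f z)
  · intro c f y
    refine tendsto_nhds_unique (hL f (c • y)) ?_
    simpa using (hL f y).const_mul c
  · intro f y
    exact le_of_tendsto (hL f y).norm (Eventually.of_forall fun i => hbd i f y)

theorem norm_dualOp_le (T : E →L[𝕜] E) : ‖dualOp T‖ ≤ ‖T‖ :=
  ContinuousLinearMap.opNorm_le_bound _ (norm_nonneg _) fun f =>
    (f.opNorm_comp_le T).trans_eq (mul_comm _ _)

section Limit

variable (hP : TendstoWStarOT (fun i => dualOp (T i)) l P)
include hP

theorem TendstoWStarOT.tendsto_mixed (f : StrongDual 𝕜 E) (u v : E) :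
    Tendsto (fun i => f (T i u + (v - T i v))) l (𝓝 (P f u + (f - P f) v)) := by
  have h1 := tendstoWStarOT_iff.1 hP f u
  have h2 := tendstoWStarOT_iff.1 hP f v
  simpa [dualOp_apply] using h1.add (h2.const_sub (f v))

variable [NeBot l]

theorem TendstoWStarOT.eq_zero_of_mem (hmem : ∀ i y, T i y ∈ X) {f : StrongDual 𝕜 E}
    (hf : f ∈ annihilatorDual X) : P f = 0 := by
  ext y
  refine tendsto_nhds_unique (tendstoWStarOT_iff.1 hP f y) ?_
  simp only [dualOp_apply, hf _ (hmem _ y)]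
  exact tendsto_const_nhds

theorem TendstoWStarOT.sub_mem (hx : ∀ x ∈ X, Tendsto (fun i => T i x) l (𝓝 x))
    (f : StrongDual 𝕜 E) : f - P f ∈ annihilatorDual X := by
  intro x hxX
  rw [_root_.sub_apply, sub_eq_zero]
  exact tendsto_nhds_unique ((f.continuous.tendsto x).comp (hx x hxX))
    (tendstoWStarOT_iff.1 hP f x)

end Limit

variable [Preorder ι]

/-- The estimate behind the `L`-projection property of `P`, from the asymptotic bound `limsup_le`. -/
theorem IsMai.norm_limit_le (hT : IsMai X T) [NeBot l] (hl : l ≤ atTop)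
    (hP : TendstoWStarOT (fun i => dualOp (T i)) l P) (f : StrongDual 𝕜 E) (u v : E) :
    ‖P f u + (f - P f) v‖ ≤ ‖f‖ * max ‖u‖ ‖v‖ := by
  refine norm_le_of_limsup_ofReal_le (N := fun i => ‖T i u + (v - T i v)‖) hl (norm_nonneg f)
    (by positivity) (hP.tendsto_mixed f u v) ?_ fun i => f.le_opNorm _
  simpa only [ofReal_norm, ENNReal.ofReal_max] using hT.limsup_le u v

/-- The same estimate for weak contractive approximate identities. Here `limsup_le` gives it for
`u ∈ X` only; but `P f u = lim P f (T_α u)`, because `P (P f) = P f`, and the `T_α u` lie in `X`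
and are no longer than `u`. -/
theorem IsWeakContractiveMai.norm_limit_le (hT : IsWeakContractiveMai X T) [NeBot l]
    (hl : l ≤ atTop) (hP : TendstoWStarOT (fun i => dualOp (T i)) l P) (f : StrongDual 𝕜 E)
    (u v : E) : ‖P f u + (f - P f) v‖ ≤ ‖f‖ * max ‖u‖ ‖v‖ := by
  have key : ∀ u ∈ X, ‖P f u + (f - P f) v‖ ≤ ‖f‖ * max ‖u‖ ‖v‖ := by
    intro u hu
    refine norm_le_of_limsup_ofReal_le (N := fun i => ‖T i u + (v - T i v)‖) hl (norm_nonneg f)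
      (by positivity) (hP.tendsto_mixed f u v) ?_ fun i => f.le_opNorm _
    simpa only [ofReal_norm, ENNReal.ofReal_max] using hT.limsup_le u hu v
  have hPP : P (P f) = P f := by
    have := hP.eq_zero_of_mem hT.mem (hP.sub_mem (fun x hx => (hT.tendsto x hx).mono_left hl) f)
    rw [map_sub, sub_eq_zero] at this
    exact this.symm
  have h1 := tendstoWStarOT_iff.1 hP (P f) u
  rw [hPP] at h1
  refine le_of_tendsto (h1.add_const ((f - P f) v)).norm (Eventually.of_forall fun i => ?_)
  refine (key _ (hT.mem i u)).trans ?_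
  gcongr
  exact ((T i).le_opNorm u).trans (mul_le_of_le_one_left (norm_nonneg _) (hT.contractive i))

omit [Preorder ι]

/-! ### `L`-projections and `M`-projections -/

/-- If `|g u + h v| ≤ c max(‖u‖, ‖v‖)` for all `u`, `v`, then `‖g‖ + ‖h‖ ≤ c`. -/
theorem norm_add_norm_le_of_forall {g h : StrongDual 𝕜 E} {c : ℝ} (hc : 0 ≤ c)
    (H : ∀ u v : E, ‖g u + h v‖ ≤ c * max ‖u‖ ‖v‖) : ‖g‖ + ‖h‖ ≤ c := by
  -- multiplying `u` and `v` by phases separates the two terms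
  have h1 : ∀ u v : E, ‖u‖ ≤ 1 → ‖v‖ ≤ 1 → ‖g u‖ + ‖h v‖ ≤ c := by
    intro u v hu hv
    obtain ⟨a, ha, ha'⟩ := RCLike.exists_norm_eq_mul_self (g u)
    obtain ⟨b, hb, hb'⟩ := RCLike.exists_norm_eq_mul_self (h v)
    have h2 := H (a • u) (b • v)
    rw [map_smul, map_smul, smul_eq_mul, smul_eq_mul, ← ha', ← hb', norm_smul, norm_smul, ha, hb,
      one_mul, one_mul, ← RCLike.ofReal_add, RCLike.norm_ofReal,
      abs_of_nonneg (by positivity)] at h2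
    exact h2.trans (mul_le_of_le_one_right hc (max_le hu hv))
  have h2 : ∀ v : E, ‖v‖ ≤ 1 → ‖g‖ ≤ c - ‖h v‖ := by
    intro v hv
    refine ContinuousLinearMap.opNorm_le_of_unit_norm (𝕜 := 𝕜) ?_ fun u hu => ?_
    · have := h1 0 v (by simp) hv
      simp only [map_zero, norm_zero] at this
      linarith
    · linarith [h1 u v hu.le hv]
  have h3 : ‖h‖ ≤ c - ‖g‖ := by
    refine ContinuousLinearMap.opNorm_le_of_unit_norm (𝕜 := 𝕜) ?_ fun v hv => ?_
    · simpa using h2 0 (by simp)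
    · linarith [h2 v hv.le]
  linarith

theorem isLprojection_of_norm_le (h0 : ∀ f ∈ annihilatorDual X, P f = 0)
    (hsub : ∀ f, f - P f ∈ annihilatorDual X)
    (hn : ∀ f u v, ‖P f u + (f - P f) v‖ ≤ ‖f‖ * max ‖u‖ ‖v‖) :
    IsLprojection (StrongDual 𝕜 E) P := by
  refine ⟨?_, fun f => le_antisymm ?_ (norm_add_norm_le_of_forall (norm_nonneg f) (hn f))⟩
  · refine ContinuousLinearMap.ext fun f => ?_
    have := h0 _ (hsub f)
    rw [map_sub, sub_eq_zero] at this
    exact this.symm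
  · calc ‖f‖ = ‖P f + (f - P f)‖ := by rw [add_sub_cancel]
      _ ≤ _ := norm_add_le _ _

/-- An `L`-projection is determined by its kernel, because any two of them commute. -/
theorem IsLprojection.eq_of_ker_eq {Q : StrongDual 𝕜 E →L[𝕜] StrongDual 𝕜 E}
    (hP : IsLprojection (StrongDual 𝕜 E) P) (hQ : IsLprojection (StrongDual 𝕜 E) Q)
    (h : Q.ker = P.ker) : Q = P := by
  have aux : ∀ A B : StrongDual 𝕜 E →L[𝕜] StrongDual 𝕜 E, IsIdempotentElem B →
      B.ker = A.ker → A * B = A := by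
    intro A B hB hker
    refine ContinuousLinearMap.ext fun f => ?_
    have h1 : f - B f ∈ B.ker := by
      have h2 : B (B f) = B f := DFunLike.congr_fun hB.eq f
      rw [LinearMap.mem_ker]
      change B (f - B f) = 0
      rw [map_sub, h2, sub_self]
    rw [hker, LinearMap.mem_ker] at h1
    have h3 : A (f - B f) = 0 := h1
    rw [map_sub, sub_eq_zero] at h3
    exact h3.symm
  exact (aux Q P hP.proj h.symm).symm.trans ((hP.commute hQ).eq.symm.trans (aux P Q hQ.proj h))

theorem IsLprojection.norm_apply_le (hP : IsLprojection (StrongDual 𝕜 E) P) (f : StrongDual 𝕜 E) :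
    ‖P f‖ ≤ ‖f‖ := by
  rw [hP.Lnorm f]
  exact le_add_of_nonneg_right (norm_nonneg _)

theorem IsLprojection.opNorm_le_one (hP : IsLprojection (StrongDual 𝕜 E) P) : ‖P‖ ≤ 1 :=
  P.opNorm_le_bound zero_le_one fun f => by rw [one_mul]; exact hP.norm_apply_le f

theorem IsLprojection.apply_apply (hP : IsLprojection (StrongDual 𝕜 E) P) (f : StrongDual 𝕜 E) :
    P (P f) = P f := DFunLike.congr_fun hP.proj.eq f

/-- The adjoint of an `L`-projection is an `M`-projection. -/
theorem IsLprojection.isMprojection_dualOp (hP : IsLprojection (StrongDual 𝕜 E) P) :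
    IsMprojection (StrongDual 𝕜 (StrongDual 𝕜 E)) (dualOp P) := by
  refine ⟨?_, fun F => le_antisymm ?_ (max_le ?_ ?_)⟩
  · ext F f
    exact congrArg F (hP.apply_apply f)
  · refine F.opNorm_le_bound (by positivity) fun f => ?_
    have e : F f = dualOp P F (P f) + (F - dualOp P F) (f - P f) := by
      simp [dualOp_apply, hP.apply_apply]
    have h1 := (dualOp P F).le_opNorm (P f)
    have h2 := (F - dualOp P F).le_opNorm (f - P f)
    have h3 : ‖f‖ = ‖P f‖ + ‖f - P f‖ := hP.Lnorm f
    change _ ≤ max ‖dualOp P F‖ ‖F - dualOp P F‖ * ‖f‖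
    rw [e, h3, mul_add]
    refine (norm_add_le _ _).trans (add_le_add (h1.trans ?_) (h2.trans ?_)) <;> gcongr
    · exact le_max_left _ _
    · exact le_max_right _ _
  · exact norm_dualOp_apply_le hP.opNorm_le_one F
  · have e : F - dualOp P F = dualOp (1 - P) F := by
      ext f
      exact (map_sub F f (P f)).symm
    change ‖F - dualOp P F‖ ≤ _
    rw [e]
    exact norm_dualOp_apply_le hP.Lcomplement.opNorm_le_one F

theorem range_dualOp (hP : IsLprojection (StrongDual 𝕜 E) P) (hker : P.ker = annihilatorDual X) :
    (dualOp P).range = biannihilator X := by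
  ext F
  constructor
  · rintro ⟨G, rfl⟩ f hf
    rw [← hker, LinearMap.mem_ker] at hf
    change G (P f) = 0
    rw [show P f = 0 from hf, map_zero]
  · intro hF
    refine ⟨F, ?_⟩
    ext f
    have h1 : f - P f ∈ annihilatorDual X := by
      rw [← hker, LinearMap.mem_ker]
      change P (f - P f) = 0
      rw [map_sub, hP.apply_apply, sub_self]
    have h2 := hF _ h1
    rw [map_sub, sub_eq_zero] at h2
    exact h2.symm

theorem mem_range_dualOp_iff (hP : IsLprojection (StrongDual 𝕜 E) P)
    {F : StrongDual 𝕜 (StrongDual 𝕜 E)} : F ∈ (dualOp P).range ↔ ∀ f, F (P f) = F f := by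
  constructor
  · rintro ⟨G, rfl⟩ f
    exact congrArg G (hP.apply_apply f)
  · exact fun h => ⟨F, ContinuousLinearMap.ext h⟩

theorem isCompl_range_ker_dualOp (hP : IsLprojection (StrongDual 𝕜 E) P) :
    IsCompl (dualOp P).range (dualOp P).ker := by
  refine IsCompl.of_eq ?_ ?_
  · rw [eq_bot_iff]
    rintro F ⟨h1, h2⟩
    rw [Submodule.mem_bot]
    ext f
    rw [← (mem_range_dualOp_iff hP).1 h1 f]
    exact DFunLike.congr_fun (LinearMap.mem_ker.1 h2) f
  · rw [eq_top_iff]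
    intro F _
    refine Submodule.mem_sup.2 ⟨dualOp P F, ⟨F, rfl⟩, F - dualOp P F, ?_, add_sub_cancel _ _⟩
    rw [LinearMap.mem_ker]
    ext f
    change (F - dualOp P F) (P f) = 0
    rw [_root_.sub_apply, dualOp_apply, hP.apply_apply, sub_self]

theorem isMSummand_range_dualOp (hP : IsLprojection (StrongDual 𝕜 E) P) :
    IsMSummand (dualOp P).range := by
  refine ⟨(dualOp P).ker, (dualOp P).isClosed_ker, isCompl_range_ker_dualOp hP, ?_⟩
  intro F hF G hG
  have h1 : dualOp P F = F := ContinuousLinearMap.ext ((mem_range_dualOp_iff hP).1 hF)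
  have h2 : dualOp P G = 0 := LinearMap.mem_ker.1 hG
  have h3 : ‖F + G‖ = max ‖dualOp P (F + G)‖ ‖(F + G) - dualOp P (F + G)‖ :=
    hP.isMprojection_dualOp.Mnorm (F + G)
  rw [h3, map_add, h1, h2, add_zero, add_sub_cancel_left]

/-! ### Convergence of the biadjoints -/

/-- The functionals `F` with `F ∘ P = 0` are annihilated in the limit by the `T_α**`. For `f` in the
range of `P` pick a norming `G ∈ X**`. As `P*` is an `M`-projection, `G + tθF` has norm at most one
for small `t > 0` and all phases `θ`, so that `|G (T_α* f)| + t |F (T_α* f)|` is essentially at most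
`‖T_α* f‖`, while already `G (T_α* f) → ‖f‖`. -/
theorem tendsto_dualOp_zero [Preorder ι] (hP : IsLprojection (StrongDual 𝕜 E) P)
    (hker : P.ker = annihilatorDual X) (hmem : ∀ i y, T i y ∈ X) (hbi : BidualTendsto X T)
    (hlim : ∀ f : StrongDual 𝕜 E, limsup (fun i => ‖dualOp (T i) f‖ₑ) atTop ≤ ‖f‖ₑ)
    {F : StrongDual 𝕜 (StrongDual 𝕜 E)} (hF : ∀ f, F (P f) = 0) (f : StrongDual 𝕜 E) :
    Tendsto (fun i => F (dualOp (T i) f)) atTop (𝓝 0) := by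
  have hf : ∀ i, dualOp (T i) f = dualOp (T i) (P f) := by
    intro i
    have h1 : f - P f ∈ annihilatorDual X := by
      rw [← hker, LinearMap.mem_ker]
      change P (f - P f) = 0
      rw [map_sub, hP.apply_apply, sub_self]
    ext y
    have h2 := h1 _ (hmem i y)
    rwa [_root_.sub_apply, sub_eq_zero] at h2
  simp only [hf]
  set g := P f with hg
  have hgg : P g = g := hP.apply_apply f
  obtain ⟨G₀, hG₀, hG₀g⟩ := exists_dual_vector'' 𝕜 g
  set G := dualOp P G₀ with hG
  have hGn : ‖G‖ ≤ 1 := (norm_dualOp_apply_le hP.opNorm_le_one G₀).trans hG₀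
  have hGg : G g = ‖g‖ := by rw [hG, dualOp_apply, hgg, hG₀g]
  have hGX : G ∈ biannihilator X := range_dualOp hP hker ▸ ⟨G₀, rfl⟩
  have hGt : Tendsto (fun i => G (dualOp (T i) g)) atTop (𝓝 (G g)) :=
    tendsto_iff_forall_eval_tendsto_topDualPairing.1 (hbi G hGX) g
  set t : ℝ := (‖F‖ + 1)⁻¹ with ht
  have ht0 : 0 < t := by positivity
  have htF : t * ‖F‖ ≤ 1 := by
    rw [ht, inv_mul_le_iff₀ (by positivity)]
    linarith
  -- the perturbed functionals are contractive
  have hpert : ∀ θ : 𝕜, ‖θ‖ = 1 → ‖G + ((t : 𝕜) * θ) • F‖ ≤ 1 := by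
    intro θ hθ
    have h1 : dualOp P (G + ((t : 𝕜) * θ) • F) = G := by
      ext f
      simp [dualOp_apply, hF, hG, hP.apply_apply]
    have h2 : ‖G + ((t : 𝕜) * θ) • F‖ = max ‖dualOp P (G + ((t : 𝕜) * θ) • F)‖
        ‖(G + ((t : 𝕜) * θ) • F) - dualOp P (G + ((t : 𝕜) * θ) • F)‖ :=
      hP.isMprojection_dualOp.Mnorm _
    rw [h2, h1, add_sub_cancel_left, norm_smul, norm_mul, hθ, mul_one, RCLike.norm_ofReal,
      abs_of_pos ht0]
    exact max_le hGn htF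
  have hbound : ∀ i, RCLike.re (G (dualOp (T i) g)) + t * ‖F (dualOp (T i) g)‖
      ≤ ‖dualOp (T i) g‖ := by
    intro i
    obtain ⟨θ, hθ, hθ'⟩ := RCLike.exists_norm_eq_mul_self (F (dualOp (T i) g))
    have h1 := (G + ((t : 𝕜) * θ) • F).le_of_opNorm_le (hpert θ hθ) (dualOp (T i) g)
    rw [one_mul] at h1
    refine le_trans (le_of_eq ?_) ((RCLike.re_le_norm _).trans h1)
    rw [_root_.add_apply, _root_.smul_apply, smul_eq_mul, mul_assoc, ← hθ',
      map_add, ← RCLike.ofReal_mul, RCLike.ofReal_re]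
  rw [Metric.tendsto_nhds]
  intro ε hε
  have hδ : 0 < t * ε / 2 := by positivity
  have ev1 : ∀ᶠ i in atTop, ‖dualOp (T i) g‖ < ‖g‖ + t * ε / 2 := by
    have h1 : limsup (fun i => ‖dualOp (T i) g‖ₑ) atTop < ENNReal.ofReal (‖g‖ + t * ε / 2) := by
      refine (hlim g).trans_lt ?_
      rw [← ofReal_norm, ENNReal.ofReal_lt_ofReal_iff (by positivity)]
      linarith
    filter_upwards [eventually_lt_of_limsup_lt h1] with i hi
    rwa [← ofReal_norm, ENNReal.ofReal_lt_ofReal_iff (by positivity)] at hi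
  have ev2 : ∀ᶠ i in atTop, ‖g‖ - t * ε / 2 < RCLike.re (G (dualOp (T i) g)) := by
    have h1 := (RCLike.continuous_re.tendsto _).comp hGt
    rw [hGg, RCLike.ofReal_re] at h1
    exact h1.eventually_const_lt (by linarith)
  filter_upwards [ev1, ev2] with i h1 h2
  rw [dist_zero_right]
  have h3 := hbound i
  have h4 : t * ‖F (dualOp (T i) g)‖ < t * ε := by linarith
  exact lt_of_mul_lt_mul_left h4 ht0.le

theorem tendstoWStarOT_bidual [Preorder ι] (hP : IsLprojection (StrongDual 𝕜 E) P)
    (hker : P.ker = annihilatorDual X) (hmem : ∀ i y, T i y ∈ X) (hbi : BidualTendsto X T)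
    (hlim : ∀ f : StrongDual 𝕜 E, limsup (fun i => ‖dualOp (T i) f‖ₑ) atTop ≤ ‖f‖ₑ) :
    TendstoWStarOT (fun i => dualOp (dualOp (T i))) atTop (dualOp P) := by
  rw [tendstoWStarOT_iff]
  intro F f
  have hFX : dualOp P F ∈ biannihilator X := range_dualOp hP hker ▸ ⟨F, rfl⟩
  have h1 : Tendsto (fun i => dualOp P F (dualOp (T i) f)) atTop (𝓝 (dualOp P F f)) :=
    tendsto_iff_forall_eval_tendsto_topDualPairing.1 (hbi _ hFX) f
  have h2 := tendsto_dualOp_zero hP hker hmem hbi hlim (F := F - dualOp P F)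
    (fun f => by rw [_root_.sub_apply, dualOp_apply, hP.apply_apply, sub_self]) f
  simpa [dualOp_apply] using h1.add h2

/-! ### The `L`-projection of an approximate identity -/

theorem tendstoWStarOT_bidual_of_strong [Preorder ι] (hP : IsLprojection (StrongDual 𝕜 E) P)
    (hker : P.ker = annihilatorDual X)
    (hT : IsStrongMai X T ∨ (IsWeakContractiveMai X T ∧ BidualTendsto X T)) :
    TendstoWStarOT (fun i => dualOp (dualOp (T i))) atTop (dualOp P) := by
  rcases hT with hT | ⟨hT, hbi⟩
  · exact tendstoWStarOT_bidual hP hker hT.mem hT.bidual hT.limsup_dual_le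
  · refine tendstoWStarOT_bidual hP hker hT.mem hbi fun f => ?_
    rcases (atTop : Filter ι).eq_or_neBot with h | h
    · rw [h, limsup_bot]; exact bot_le
    · refine limsup_le_of_le (h := Eventually.of_forall fun i => ?_)
      rw [← ofReal_norm, ← ofReal_norm]
      exact ENNReal.ofReal_le_ofReal (norm_dualOp_apply_le (hT.contractive i) f)

/-- The adjoints of an M-approximate identity converge to an `L`-projection with kernel `X^⊥`. All
their cluster points are `L`-projections with this kernel, hence coincide. -/
theorem exists_isLprojection_tendsto [Preorder ι] [IsDirectedOrder ι] [Nonempty ι]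
    (hT : IsMai X T ∨ IsWeakContractiveMai X T) :
    ∃ P : StrongDual 𝕜 E →L[𝕜] StrongDual 𝕜 E, IsLprojection (StrongDual 𝕜 E) P ∧
      P.ker = annihilatorDual X ∧ TendstoWStarOT (fun i => dualOp (T i)) atTop P := by
  have hmem : ∀ i y, T i y ∈ X := hT.elim (·.mem) (·.mem)
  have hx : ∀ x ∈ X, Tendsto (fun i => T i x) atTop (𝓝 x) := hT.elim (·.tendsto) (·.tendsto)
  have hb : ∃ C : ℝ, ∀ i, ‖dualOp (T i)‖ ≤ C := by
    obtain ⟨C, hC⟩ : ∃ C : ℝ, ∀ i, ‖T i‖ ≤ C :=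
      hT.elim (·.bounded) fun h => ⟨1, h.contractive⟩
    exact ⟨C, fun i => (norm_dualOp_le _).trans (hC i)⟩
  have key : ∀ U : Ultrafilter ι, ↑U ≤ (atTop : Filter ι) →
      ∃ P : StrongDual 𝕜 E →L[𝕜] StrongDual 𝕜 E, IsLprojection (StrongDual 𝕜 E) P ∧
        P.ker = annihilatorDual X ∧ TendstoWStarOT (fun i => dualOp (T i)) U P := by
    intro U hU
    obtain ⟨P, hP⟩ := exists_tendstoWStarOT_ultrafilter hb U
    have h0 := fun f hf => hP.eq_zero_of_mem (f := f) hmem hf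
    have hsub := hP.sub_mem fun x hxX => (hx x hxX).mono_left hU
    refine ⟨P, isLprojection_of_norm_le h0 hsub
      (hT.elim (·.norm_limit_le hU hP) (·.norm_limit_le hU hP)), ?_, hP⟩
    ext f
    refine ⟨fun hf => ?_, fun hf => h0 f hf⟩
    have h1 := hsub f
    rwa [show P f = 0 from hf, sub_zero] at h1
  -- every ultrafilter finer than `atTop` yields the same limit
  obtain ⟨P, hP, hker, -⟩ := key (Ultrafilter.of atTop) (Ultrafilter.of_le _)
  refine ⟨P, hP, hker, ?_⟩
  rw [tendstoWStarOT_iff]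
  intro f y
  rw [tendsto_iff_ultrafilter]
  intro U hU
  obtain ⟨Q, hQ, hQker, hQt⟩ := key U hU
  rw [← hP.eq_of_ker_eq hQ (hQker.trans hker.symm)]
  exact tendstoWStarOT_iff.1 hQt f y

end Banach

/-! ### Sandwiching a linear functional -/

/-- A sandwich form of the Hahn-Banach theorem. If the convex cone `S`, thought of as the hypograph
of a superlinear function, lies below the seminorm `h`, then a linear functional separates them. -/
theorem exists_linear_between_cone_seminorm {Z : Type*} [AddCommGroup Z] [Module ℝ Z]
    (h : Seminorm ℝ Z) (S : Set (Z × ℝ)) (h0 : (0 : Z × ℝ) ∈ S)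
    (hadd : ∀ s ∈ S, ∀ t ∈ S, s + t ∈ S) (hsmul : ∀ c : ℝ, 0 < c → ∀ s ∈ S, c • s ∈ S)
    (hle : ∀ s ∈ S, s.2 ≤ h s.1) :
    ∃ ℓ : Z →ₗ[ℝ] ℝ, (∀ z, ℓ z ≤ h z) ∧ ∀ s ∈ S, s.2 ≤ ℓ s.1 := by
  have : Nonempty S := ⟨⟨0, h0⟩⟩
  -- the largest sublinear functional below `h` with `N (-c) ≤ -t` for `(c, t) ∈ S`
  set N : Z → ℝ := fun z => ⨅ s : S, (h (z + s.1.1) - s.1.2) with hN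
  have hbdd : ∀ z, BddBelow (Set.range fun s : S => h (z + s.1.1) - s.1.2) := by
    intro z
    refine ⟨-h z, ?_⟩
    rintro _ ⟨s, rfl⟩
    have h1 := hle s.1 s.2
    have h2 := map_sub_le_add h (z + s.1.1) z
    rw [add_sub_cancel_left] at h2
    change -h z ≤ h (z + s.1.1) - s.1.2
    linarith
  have hNle : ∀ z, ∀ s ∈ S, N z ≤ h (z + s.1) - s.2 := fun z s hs => ciInf_le (hbdd z) ⟨s, hs⟩
  have hom_le : ∀ c : ℝ, 0 < c → ∀ z, N (c • z) ≤ c * N z := by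
    intro c hc z
    rw [hN, Real.mul_iInf_of_nonneg hc.le]
    refine le_ciInf fun s => (hNle (c • z) (c • s.1) (hsmul c hc _ s.2)).trans (le_of_eq ?_)
    rw [Prod.smul_fst, Prod.smul_snd, ← smul_add, map_smul_eq_mul, Real.norm_of_nonneg hc.le,
      smul_eq_mul, mul_sub]
  have hom : ∀ c : ℝ, 0 < c → ∀ z, N (c • z) = c * N z := by
    intro c hc z
    refine le_antisymm (hom_le c hc z) ?_
    have h1 := hom_le c⁻¹ (inv_pos.2 hc) (c • z)
    rw [inv_smul_smul₀ hc.ne', ← div_eq_inv_mul, le_div_iff₀ hc] at h1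
    linarith
  have sub : ∀ x y, N (x + y) ≤ N x + N y := by
    intro x y
    refine le_ciInf_add_ciInf fun s t => (hNle _ _ (hadd _ s.2 _ t.2)).trans ?_
    have h1 := map_add_le_add h (x + s.1.1) (y + t.1.1)
    rw [Prod.fst_add, Prod.snd_add, add_add_add_comm]
    linarith
  have hN0 : 0 ≤ N 0 := le_ciInf fun s => by
    have := hle s.1 s.2
    rw [zero_add]
    linarith
  obtain ⟨ℓ, -, hℓ⟩ := exists_extension_of_le_sublinear (⊥ : Z →ₗ.[ℝ] ℝ) N hom sub (by
    rintro ⟨x, hx⟩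
    obtain rfl : x = 0 := (Submodule.mem_bot ℝ).1 hx
    have h1 : (⊥ : Z →ₗ.[ℝ] ℝ) ⟨0, hx⟩ = 0 := LinearPMap.map_zero _
    rw [h1]
    exact hN0)
  refine ⟨ℓ, fun z => (hℓ z).trans ?_, fun s hs => ?_⟩
  · simpa using hNle z 0 h0
  · have h1 := (hℓ (-s.1)).trans (hNle (-s.1) s hs)
    rw [neg_add_cancel, map_zero, map_neg] at h1
    linarith

section Matrices

open scoped Matrix.Norms.L2Operator MatrixOrder ComplexOrder
open Matrix

theorem re_trace_mul_conjTranspose {m n : Type*} [Fintype m] [Fintype n] (a : Matrix m n ℂ) :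
    (a * aᴴ).trace.re = ∑ i, ∑ k, ‖a i k‖ ^ 2 := by
  simp only [trace, diag_apply, mul_apply, conjTranspose_apply, Complex.re_sum]
  refine Finset.sum_congr rfl fun i _ => Finset.sum_congr rfl fun k _ => ?_
  rw [← Complex.normSq_eq_norm_sq, Complex.star_def, Complex.mul_conj, Complex.ofReal_re]

/-- Every real linear functional on complex matrices is of the form `A ↦ Re tr (D A)`. -/
theorem exists_eq_re_trace {n : ℕ} (p : Matrix (Fin n) (Fin n) ℂ →ₗ[ℝ] ℝ) :
    ∃ D : Matrix (Fin n) (Fin n) ℂ, ∀ A, p A = (D * A).trace.re := by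
  refine ⟨Matrix.of fun j i => p (single i j 1) - Complex.I * p (single i j Complex.I),
    fun A => ?_⟩
  have h1 : ∀ i j (z : ℂ), p (single i j z)
      = ((p (single i j 1) - Complex.I * p (single i j Complex.I)) * z).re := by
    intro i j z
    have e : (single i j z : Matrix (Fin n) (Fin n) ℂ)
        = z.re • single i j 1 + z.im • single i j Complex.I := by
      rw [smul_single, smul_single, ← single_add]
      congr 1
      simp [Complex.re_add_im]
    rw [e, map_add, map_smul, map_smul]
    simp
    ring
  conv_lhs => rw [matrix_eq_sum_single A]
  simp only [map_sum]
  rw [trace, Complex.re_sum, Finset.sum_comm]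
  refine Finset.sum_congr rfl fun j _ => ?_
  rw [diag_apply, mul_apply, Complex.re_sum]
  exact Finset.sum_congr rfl fun i _ => h1 i j (A i j)

/-- A real functional which is nonnegative on rank one projections becomes, after adding a small
multiple of the trace, a quadratic form `a aᴴ ↦ ‖B a‖²` (Hilbert-Schmidt norm) with invertible
`B`. -/
theorem exists_isUnit_hilbertSchmidt {n : ℕ} (p : Matrix (Fin n) (Fin n) ℂ →ₗ[ℝ] ℝ)
    (hp : ∀ v : Fin n → ℂ, 0 ≤ p (vecMulVec v (star v))) {ε : ℝ} (hε : 0 < ε) :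
    ∃ B : Matrix (Fin n) (Fin n) ℂ, IsUnit B ∧ ∀ (r : ℕ) (a : Matrix (Fin n) (Fin r) ℂ),
      ∑ i, ∑ k, ‖(B * a) i k‖ ^ 2 = p (a * aᴴ) + ε * ∑ i, ∑ k, ‖a i k‖ ^ 2 := by
  obtain ⟨D, hD⟩ := exists_eq_re_trace p
  -- only Hermitian arguments matter, so `D` may be replaced by its Hermitian part
  set H : Matrix (Fin n) (Fin n) ℂ := (1 / 2 : ℂ) • (D + Dᴴ) + (ε : ℂ) • 1 with hH
  have hHh : H.IsHermitian := by
    rw [hH, IsHermitian, conjTranspose_add, conjTranspose_smul, conjTranspose_smul,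
      conjTranspose_add, conjTranspose_conjTranspose, conjTranspose_one, add_comm Dᴴ]
    congr 2 <;> simp
  have htr : ∀ A : Matrix (Fin n) (Fin n) ℂ, A.IsHermitian →
      (H * A).trace.re = p A + ε * A.trace.re := by
    intro A hA
    have h1 : (Dᴴ * A).trace.re = (D * A).trace.re := by
      have : Dᴴ * A = (A * D)ᴴ := by rw [conjTranspose_mul, hA.eq]
      rw [this, trace_conjTranspose, trace_mul_comm, Complex.star_def, Complex.conj_re]
    rw [hH, add_mul, smul_mul_assoc, smul_mul_assoc, one_mul, add_mul, trace_add, trace_smul,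
      trace_smul, trace_add, hD]
    simp only [smul_eq_mul, Complex.add_re, Complex.re_ofReal_mul]
    have h2 : ((1 / 2 : ℂ) * ((D * A).trace + (Dᴴ * A).trace)).re
        = (1 / 2 : ℝ) * ((D * A).trace + (Dᴴ * A).trace).re := by
      rw [← Complex.re_ofReal_mul]
      push_cast
      rfl
    rw [h2, Complex.add_re, h1]
    ring
  have hpos : H.PosDef := by
    refine PosDef.of_dotProduct_mulVec_pos hHh fun v hv => ?_
    have him : (star v ⬝ᵥ H *ᵥ v).im = 0 := hHh.im_star_dotProduct_mulVec_self v
    have e : star v ⬝ᵥ H *ᵥ v = (H * vecMulVec v (star v)).trace := by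
      rw [mul_vecMulVec, trace_vecMulVec, dotProduct_comm]
    have e2 : (vecMulVec v (star v)).trace.re = ∑ i, ‖v i‖ ^ 2 := by
      simp [trace_vecMulVec, dotProduct, Complex.mul_conj, Complex.normSq_eq_norm_sq,
        -Complex.ofReal_pow]
    have hv' : 0 < ∑ i, ‖v i‖ ^ 2 := by
      obtain ⟨i, hi⟩ := Function.ne_iff.1 hv
      refine Finset.sum_pos' (fun _ _ => by positivity) ⟨i, Finset.mem_univ i, ?_⟩
      have : 0 < ‖v i‖ := norm_pos_iff.2 hi
      positivity
    have hre : 0 < (star v ⬝ᵥ H *ᵥ v).re := by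
      rw [e, htr _ (posSemidef_vecMulVec_self_star v).isHermitian, e2]
      have := hp v
      positivity
    exact Complex.pos_iff.2 ⟨hre, him.symm⟩
  obtain ⟨B, hB⟩ := CStarAlgebra.nonneg_iff_eq_star_mul_self.mp hpos.posSemidef.nonneg
  refine ⟨B, ?_, fun r a => ?_⟩
  · have h1 := hpos.isUnit
    rw [hB] at h1
    exact isUnit_of_mul_isUnit_right h1
  · rw [← re_trace_mul_conjTranspose, ← re_trace_mul_conjTranspose,
      ← htr _ (isHermitian_mul_conjTranspose_self a), hB, conjTranspose_mul, star_eq_conjTranspose]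
    rw [← Matrix.mul_assoc, trace_mul_comm, Matrix.mul_assoc, Matrix.mul_assoc]

end Matrices

/-! ### The pairing of matrices over `E*` and `E` -/

section MatrixPairing

open scoped Matrix.Norms.L2Operator
open Matrix

variable {E : Type*} [NormedAddCommGroup E] [NormedSpace ℂ E]

/-- The pairing `⟨φ, y⟩ = ∑ φ_{ij}(y_{ij})` of `M_n(E*)` and `M_n(E)`. -/
noncomputable def matrixPairing {n : ℕ} (φ : Matrix (Fin n) (Fin n) (StrongDual ℂ E))
    (y : Matrix (Fin n) (Fin n) E) : ℂ := ∑ i, ∑ j, φ i j (y i j)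

theorem sandwich_sandwich {E : Type*} [AddCommGroup E] [Module ℂ E] {m n r : ℕ}
    (a : Matrix (Fin r) (Fin n) ℂ) (c : Matrix (Fin n) (Fin m) ℂ) (x : Matrix (Fin m) (Fin m) E)
    (d : Matrix (Fin m) (Fin n) ℂ) (b : Matrix (Fin n) (Fin r) ℂ) :
    sandwich a (sandwich c x d) b = sandwich (a * c) x (d * b) := by
  ext i j
  simp only [sandwich, of_apply, mul_apply, Finset.smul_sum, smul_smul, Finset.sum_mul_sum,
    Finset.sum_smul]
  calc _ = ∑ k, ∑ l, ∑ s, ∑ t, (a i k * b l j * (c k s * d t l)) • x s t := rfl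
    _ = ∑ k, ∑ s, ∑ l, ∑ t, (a i k * b l j * (c k s * d t l)) • x s t :=
        Finset.sum_congr rfl fun k _ => Finset.sum_comm
    _ = ∑ s, ∑ k, ∑ l, ∑ t, (a i k * b l j * (c k s * d t l)) • x s t := Finset.sum_comm
    _ = ∑ s, ∑ k, ∑ t, ∑ l, (a i k * b l j * (c k s * d t l)) • x s t :=
        Finset.sum_congr rfl fun s _ => Finset.sum_congr rfl fun k _ => Finset.sum_comm
    _ = ∑ s, ∑ t, ∑ k, ∑ l, (a i k * b l j * (c k s * d t l)) • x s t :=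
        Finset.sum_congr rfl fun s _ => Finset.sum_comm
    _ = _ := by
        refine Finset.sum_congr rfl fun s _ => Finset.sum_congr rfl fun t _ =>
          Finset.sum_congr rfl fun k _ => Finset.sum_congr rfl fun l _ => ?_
        congr 1
        ring

theorem one_sandwich_one {E : Type*} [AddCommGroup E] [Module ℂ E] {n : ℕ}
    (x : Matrix (Fin n) (Fin n) E) : sandwich 1 x 1 = x := by
  ext i j
  simp [sandwich, one_apply, ite_smul]

theorem matrixPairing_sandwich {m n : ℕ} (φ : Matrix (Fin n) (Fin n) (StrongDual ℂ E))
    (a : Matrix (Fin n) (Fin m) ℂ) (y : Matrix (Fin m) (Fin m) E) (b : Matrix (Fin m) (Fin n) ℂ) :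
    matrixPairing φ (sandwich a y b) = matrixPairing (sandwich aᵀ φ bᵀ) y := by
  simp only [matrixPairing, sandwich, of_apply, map_sum, map_smul, _root_.sum_apply,
    _root_.smul_apply, transpose_apply]
  calc _ = ∑ i, ∑ j, ∑ k, ∑ l, (a i k * b l j) • φ i j (y k l) := rfl
    _ = ∑ i, ∑ k, ∑ j, ∑ l, (a i k * b l j) • φ i j (y k l) :=
        Finset.sum_congr rfl fun i _ => Finset.sum_comm
    _ = ∑ k, ∑ i, ∑ j, ∑ l, (a i k * b l j) • φ i j (y k l) := Finset.sum_comm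
    _ = ∑ k, ∑ i, ∑ l, ∑ j, (a i k * b l j) • φ i j (y k l) :=
        Finset.sum_congr rfl fun k _ => Finset.sum_congr rfl fun i _ => Finset.sum_comm
    _ = ∑ k, ∑ l, ∑ i, ∑ j, (a i k * b l j) • φ i j (y k l) :=
        Finset.sum_congr rfl fun k _ => Finset.sum_comm

/-- The bilinear form of `(f_{ij}(y_{kl}))` in terms of the pairing. -/
theorem sum_mul_pairMatrix_mul {m n : ℕ} (f : Matrix (Fin n) (Fin n) (StrongDual ℂ E))
    (y : Matrix (Fin m) (Fin m) E) (ξ η : Fin n × Fin m → ℂ) :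
    ∑ p, ∑ q, ξ p * pairMatrix f y p q * η q
      = matrixPairing f (sandwich (of fun i k => ξ (i, k)) y (of fun l j => η (j, l))) := by
  simp only [matrixPairing, sandwich, of_apply, map_sum, map_smul, Fintype.sum_prod_type,
    pairMatrix, smul_eq_mul]
  refine Finset.sum_congr rfl fun i _ => ?_
  rw [Finset.sum_comm]
  refine Finset.sum_congr rfl fun j _ => Finset.sum_congr rfl fun k _ =>
    Finset.sum_congr rfl fun l _ => by ring

theorem norm_transpose_le {m n : ℕ} (b : Matrix (Fin n) (Fin m) ℂ) : ‖bᵀ‖ ≤ ‖b‖ := by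
  refine l2_le_of_bilin _ (norm_nonneg _) fun ξ η => ?_
  have h1 := bilin_le_l2 b η ξ
  rw [Finset.sum_comm] at h1
  refine le_trans (le_of_eq ?_) (h1.trans (le_of_eq (mul_right_comm _ _ _)))
  congr 1
  exact Finset.sum_congr rfl fun i _ => Finset.sum_congr rfl fun j _ => by
    rw [transpose_apply]; ring

theorem norm_matrix_one_le (n : ℕ) : ‖(1 : Matrix (Fin n) (Fin n) ℂ)‖ ≤ 1 := by
  have h := l2_opNorm_conjTranspose_mul_self (1 : Matrix (Fin n) (Fin n) ℂ)
  rw [conjTranspose_one, one_mul] at h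
  nlinarith [norm_nonneg (1 : Matrix (Fin n) (Fin n) ℂ)]

theorem l2_norm_le_one_of_two_re_le {ι κ : Type*} [Fintype ι] [Fintype κ] [DecidableEq κ]
    (A : Matrix ι κ ℂ) (h : ∀ (ξ : ι → ℂ) (η : κ → ℂ),
      2 * (∑ p, ∑ q, ξ p * A p q * η q).re ≤ ∑ p, ‖ξ p‖ ^ 2 + ∑ q, ‖η q‖ ^ 2) : ‖A‖ ≤ 1 := by
  refine l2_le_of_bilin _ zero_le_one fun ξ η => ?_
  rcases eq_or_ne ξ 0 with rfl | hξ
  · simp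
  rcases eq_or_ne η 0 with rfl | hη
  · simp
  set x := ‖WithLp.toLp 2 ξ‖ with hx
  set y := ‖WithLp.toLp 2 η‖ with hy
  have hx0 : 0 < x := norm_pos_iff.2 fun h0 => hξ (by simpa using h0)
  have hy0 : 0 < y := norm_pos_iff.2 fun h0 => hη (by simpa using h0)
  have hx2 : ∑ p, ‖ξ p‖ ^ 2 = x ^ 2 := (EuclideanSpace.norm_sq_eq _).symm
  have hy2 : ∑ q, ‖η q‖ ^ 2 = y ^ 2 := (EuclideanSpace.norm_sq_eq _).symm
  set W := ∑ p, ∑ q, ξ p * A p q * η q with hW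
  obtain ⟨θ, hθ, hθ'⟩ := RCLike.exists_norm_eq_mul_self W
  -- rescaling `ξ` by `‖η‖` and `η` by `‖ξ‖` makes the arithmetic-geometric mean inequality sharp
  have h1 := h (fun p => (y * θ : ℂ) * ξ p) (fun q => (x : ℂ) * η q)
  have e1 : ∑ p, ∑ q, (y * θ : ℂ) * ξ p * A p q * ((x : ℂ) * η q)
      = ((x * y * ‖W‖ : ℝ) : ℂ) := by
    have : ((‖W‖ : ℝ) : ℂ) = θ * W := hθ'
    rw [Complex.ofReal_mul, this, hW, Finset.mul_sum, Finset.mul_sum]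
    refine Finset.sum_congr rfl fun p _ => ?_
    rw [Finset.mul_sum, Finset.mul_sum]
    refine Finset.sum_congr rfl fun q _ => ?_
    push_cast
    ring
  have e2 : ∑ p, ‖(y * θ : ℂ) * ξ p‖ ^ 2 = y ^ 2 * x ^ 2 := by
    rw [← hx2, Finset.mul_sum]
    refine Finset.sum_congr rfl fun p _ => ?_
    rw [norm_mul, norm_mul, hθ, mul_one, mul_pow, Complex.norm_real, Real.norm_of_nonneg hy0.le]
  have e3 : ∑ q, ‖(x : ℂ) * η q‖ ^ 2 = x ^ 2 * y ^ 2 := by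
    rw [← hy2, Finset.mul_sum]
    refine Finset.sum_congr rfl fun q _ => ?_
    rw [norm_mul, mul_pow, Complex.norm_real, Real.norm_of_nonneg hx0.le]
  rw [e1, e2, e3, Complex.ofReal_re] at h1
  have hxy : 0 < x * y := by positivity
  nlinarith

variable [OperatorSpace E]

/-- The values of the functional `a y bᵀ ↦ 2 Re ⟨φ, a y bᵀ⟩` (`y` in a unit ball) over the pairs
`(a aᴴ, b bᴴ)`. By the direct sum axiom, it is a convex cone. -/
def factorizationCone {n : ℕ} (φ : Matrix (Fin n) (Fin n) (StrongDual ℂ E)) :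
    Set ((Matrix (Fin n) (Fin n) ℂ × Matrix (Fin n) (Fin n) ℂ) × ℝ) :=
  {s | ∃ (r : ℕ) (a b : Matrix (Fin n) (Fin r) ℂ) (y : Matrix (Fin r) (Fin r) E), mnorm y ≤ 1 ∧
    s = ((a * aᴴ, b * bᴴ), 2 * (matrixPairing φ (sandwich a y bᵀ)).re)}

theorem zero_mem_factorizationCone {n : ℕ} (φ : Matrix (Fin n) (Fin n) (StrongDual ℂ E)) :
    0 ∈ factorizationCone φ := by
  refine ⟨0, 0, 0, 0, by rw [mnorm_zero]; exact zero_le_one, ?_⟩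
  ext <;> simp [matrixPairing, sandwich]

theorem add_mem_factorizationCone {n : ℕ} (φ : Matrix (Fin n) (Fin n) (StrongDual ℂ E))
    {s t} (hs : s ∈ factorizationCone φ) (ht : t ∈ factorizationCone φ) :
    s + t ∈ factorizationCone φ := by
  obtain ⟨r, a, b, y, hy, rfl⟩ := hs
  obtain ⟨r', a', b', y', hy', rfl⟩ := ht
  refine ⟨r + r', of fun i => Fin.append (a i) (a' i), of fun i => Fin.append (b i) (b' i),
    reindex finSumFinEquiv finSumFinEquiv (fromBlocks y 0 0 y'),
    (OperatorSpace.mnorm_directSum_le y y').trans (max_le hy hy'), ?_⟩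
  have hmul : ∀ c : Matrix (Fin n) (Fin r) ℂ, ∀ c' : Matrix (Fin n) (Fin r') ℂ,
      (of fun i => Fin.append (c i) (c' i) : Matrix (Fin n) (Fin (r + r')) ℂ) *
        (of fun i => Fin.append (c i) (c' i))ᴴ = c * cᴴ + c' * c'ᴴ := by
    intro c c'
    ext i j
    simp [mul_apply, Fin.sum_univ_add]
  have hsand : sandwich (of fun i => Fin.append (a i) (a' i))
        (reindex finSumFinEquiv finSumFinEquiv (fromBlocks y 0 0 y'))
        (of fun i => Fin.append (b i) (b' i))ᵀ = sandwich a y bᵀ + sandwich a' y' b'ᵀ := by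
    ext i j
    simp [sandwich, Fin.sum_univ_add]
  rw [hmul, hmul, hsand]
  ext <;> simp [matrixPairing, Finset.sum_add_distrib, mul_add]

theorem smul_mem_factorizationCone {n : ℕ} (φ : Matrix (Fin n) (Fin n) (StrongDual ℂ E))
    {c : ℝ} (hc : 0 < c) {s} (hs : s ∈ factorizationCone φ) : c • s ∈ factorizationCone φ := by
  obtain ⟨r, a, b, y, hy, rfl⟩ := hs
  refine ⟨r, ((√c : ℝ) : ℂ) • a, ((√c : ℝ) : ℂ) • b, y, hy, ?_⟩
  have hcc : ((√c : ℝ) : ℂ) * ((√c : ℝ) : ℂ) = (c : ℂ) := by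
    rw [← Complex.ofReal_mul, Real.mul_self_sqrt hc.le]
  have hmul : ∀ d : Matrix (Fin n) (Fin r) ℂ,
      (((√c : ℝ) : ℂ) • d) * (((√c : ℝ) : ℂ) • d)ᴴ = c • (d * dᴴ) := by
    intro d
    rw [conjTranspose_smul, Matrix.smul_mul, Matrix.mul_smul, smul_smul, Complex.star_def,
      Complex.conj_ofReal, hcc]
    rfl
  have hsand : sandwich (((√c : ℝ) : ℂ) • a) y (((√c : ℝ) : ℂ) • b)ᵀ
      = (c : ℂ) • sandwich a y bᵀ := by
    ext i j
    simp only [sandwich, of_apply, Matrix.smul_apply, transpose_apply, smul_eq_mul, Finset.smul_sum,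
      smul_smul, ← hcc]
    exact Finset.sum_congr rfl fun k _ => Finset.sum_congr rfl fun l _ => by congr 1; ring
  have hpair : matrixPairing φ ((c : ℂ) • sandwich a y bᵀ)
      = (c : ℂ) * matrixPairing φ (sandwich a y bᵀ) := by
    simp [matrixPairing, Finset.mul_sum]
  rw [hmul, hmul, hsand, hpair, Complex.re_ofReal_mul]
  ext <;> simp
  ring

/-- The seminorm `(A, B) ↦ c (‖A‖ + ‖B‖)`. -/
noncomputable def scaledSumSeminorm (n : ℕ) {c : ℝ} (hc : 0 ≤ c) :
    Seminorm ℝ (Matrix (Fin n) (Fin n) ℂ × Matrix (Fin n) (Fin n) ℂ) :=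
  Seminorm.of (fun z => c * (‖z.1‖ + ‖z.2‖))
    (fun x y => by
      rw [← mul_add]
      have h1 := norm_add_le x.1 y.1
      have h2 := norm_add_le x.2 y.2
      refine mul_le_mul_of_nonneg_left ?_ hc
      rw [Prod.fst_add, Prod.snd_add]
      linarith)
    (fun t x => by rw [Prod.smul_fst, Prod.smul_snd, norm_smul, norm_smul]; ring)

theorem le_of_mem_factorizationCone {n : ℕ} {φ : Matrix (Fin n) (Fin n) (StrongDual ℂ E)}
    {c : ℝ} (hc : 0 ≤ c) (hφ : ∀ y, ‖matrixPairing φ y‖ ≤ c * mnorm y) {s}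
    (hs : s ∈ factorizationCone φ) : s.2 ≤ scaledSumSeminorm n hc s.1 := by
  obtain ⟨r, a, b, y, hy, rfl⟩ := hs
  have hcs : ∀ d : Matrix (Fin n) (Fin r) ℂ, ‖d * dᴴ‖ = ‖d‖ * ‖d‖ := by
    intro d
    have := l2_opNorm_conjTranspose_mul_self dᴴ
    rwa [conjTranspose_conjTranspose, l2_opNorm_conjTranspose] at this
  change 2 * (matrixPairing φ (sandwich a y bᵀ)).re ≤ c * (‖a * aᴴ‖ + ‖b * bᴴ‖)
  rw [hcs, hcs]
  have h1 : (matrixPairing φ (sandwich a y bᵀ)).re ≤ c * mnorm (sandwich a y bᵀ) :=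
    (Complex.re_le_norm _).trans (hφ _)
  have h2 : mnorm (sandwich a y bᵀ) ≤ ‖a‖ * ‖b‖ := by
    refine (OperatorSpace.mnorm_sandwich_le a y bᵀ).trans ?_
    change ‖a‖ * mnorm y * ‖bᵀ‖ ≤ _
    have h3 := norm_transpose_le b
    have h4 : ‖a‖ * mnorm y ≤ ‖a‖ := mul_le_of_le_one_right (norm_nonneg _) hy
    gcongr
  have h3 : 2 * (‖a‖ * ‖b‖) ≤ ‖a‖ * ‖a‖ + ‖b‖ * ‖b‖ := by nlinarith [sq_nonneg (‖a‖ - ‖b‖)]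
  nlinarith [mul_le_mul_of_nonneg_left h2 hc, mul_le_mul_of_nonneg_left h3 hc]

/-- Every functional `φ` of norm at most `c` on `M_n(E)` factors, up to `ε`, as `Bᵀ f C` with `f` in
the unit ball of `M_n(E*)` and matrices `B`, `C` of Hilbert-Schmidt norm at most `√c`. -/
theorem exists_factorization {n : ℕ} {φ : Matrix (Fin n) (Fin n) (StrongDual ℂ E)} {c : ℝ}
    (hc : 0 ≤ c) (hφ : ∀ y, ‖matrixPairing φ y‖ ≤ c * mnorm y) {ε : ℝ} (hε : 0 < ε) :
    ∃ (B C : Matrix (Fin n) (Fin n) ℂ) (f : Matrix (Fin n) (Fin n) (StrongDual ℂ E)),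
      ∑ i, ∑ k, ‖B i k‖ ^ 2 ≤ c + ε * n ∧ ∑ i, ∑ k, ‖C i k‖ ^ 2 ≤ c + ε * n ∧
      dualMnorm f ≤ 1 ∧ φ = sandwich Bᵀ f C := by
  obtain ⟨ℓ, hℓle, hℓ⟩ := exists_linear_between_cone_seminorm (scaledSumSeminorm n hc)
    (factorizationCone φ) (zero_mem_factorizationCone φ)
    (fun s hs t ht => add_mem_factorizationCone φ hs ht)
    (fun d hd s hs => smul_mem_factorizationCone φ hd hs)
    (fun s hs => le_of_mem_factorizationCone hc hφ hs)
  have hcone : ∀ (r : ℕ) (a b : Matrix (Fin n) (Fin r) ℂ) (y : Matrix (Fin r) (Fin r) E),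
      mnorm y ≤ 1 → 2 * (matrixPairing φ (sandwich a y bᵀ)).re ≤ ℓ (a * aᴴ, b * bᴴ) :=
    fun r a b y hy => hℓ _ ⟨r, a, b, y, hy, rfl⟩
  set p : Matrix (Fin n) (Fin n) ℂ →ₗ[ℝ] ℝ := ℓ ∘ₗ LinearMap.inl ℝ _ _ with hp
  set q : Matrix (Fin n) (Fin n) ℂ →ₗ[ℝ] ℝ := ℓ ∘ₗ LinearMap.inr ℝ _ _ with hq
  have hpq : ∀ A A', ℓ (A, A') = p A + q A' := by
    intro A A'
    rw [hp, hq, LinearMap.comp_apply, LinearMap.comp_apply, ← map_add]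
    simp
  have hvec : ∀ v : Fin n → ℂ, vecMulVec v (star v)
      = replicateCol (Fin 1) v * (replicateCol (Fin 1) v)ᴴ := by
    intro v
    ext i j
    simp [mul_apply, vecMulVec_apply]
  have hzero : mnorm (0 : Matrix (Fin 1) (Fin 1) E) ≤ 1 := by rw [mnorm_zero]; exact zero_le_one
  have hpair0 : ∀ a b : Matrix (Fin n) (Fin 1) ℂ,
      matrixPairing φ (sandwich a (0 : Matrix (Fin 1) (Fin 1) E) bᵀ) = 0 := by
    intro a b
    simp [matrixPairing, sandwich]
  have hp0 : ∀ v : Fin n → ℂ, 0 ≤ p (vecMulVec v (star v)) := by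
    intro v
    -- `y = 0` is an admissible choice
    have h1 := hcone 1 (replicateCol (Fin 1) v) 0 0 hzero
    rwa [hpair0, Complex.zero_re, mul_zero, hpq, Matrix.zero_mul, map_zero, add_zero, ← hvec] at h1
  have hq0 : ∀ v : Fin n → ℂ, 0 ≤ q (vecMulVec v (star v)) := by
    intro v
    have h1 := hcone 1 0 (replicateCol (Fin 1) v) 0 hzero
    rwa [hpair0, Complex.zero_re, mul_zero, hpq, Matrix.zero_mul, map_zero, zero_add, ← hvec] at h1
  have hone := norm_matrix_one_le n
  have hp1 : p 1 ≤ c := by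
    have h1 : p 1 ≤ c * (‖(1 : Matrix (Fin n) (Fin n) ℂ)‖
      + ‖(0 : Matrix (Fin n) (Fin n) ℂ)‖) := hℓle (1, 0)
    rw [norm_zero, add_zero] at h1
    exact h1.trans (mul_le_of_le_one_right hc hone)
  have hq1 : q 1 ≤ c := by
    have h1 : q 1 ≤ c * (‖(0 : Matrix (Fin n) (Fin n) ℂ)‖
      + ‖(1 : Matrix (Fin n) (Fin n) ℂ)‖) := hℓle (0, 1)
    rw [norm_zero, zero_add] at h1
    exact h1.trans (mul_le_of_le_one_right hc hone)
  have hsum1 : ∑ i : Fin n, ∑ k : Fin n, ‖(1 : Matrix (Fin n) (Fin n) ℂ) i k‖ ^ 2 = n := by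
    simp [one_apply, apply_ite]
  -- the part of `ε` in `B` and `C` makes them invertible, so that `f` can be solved for
  obtain ⟨B, hBu, hB⟩ := exists_isUnit_hilbertSchmidt p hp0 hε
  obtain ⟨C, hCu, hC⟩ := exists_isUnit_hilbertSchmidt q hq0 hε
  have hBdet := (isUnit_iff_isUnit_det B).1 hBu
  have hCdet := (isUnit_iff_isUnit_det C).1 hCu
  refine ⟨B, C, sandwich (B⁻¹)ᵀ φ C⁻¹, ?_, ?_, ?_, ?_⟩
  · have h1 := hB n 1
    rw [mul_one, conjTranspose_one, mul_one, hsum1] at h1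
    rw [h1]
    linarith
  · have h1 := hC n 1
    rw [mul_one, conjTranspose_one, mul_one, hsum1] at h1
    rw [h1]
    linarith
  · refine ciSup_le fun y => ?_
    obtain ⟨⟨r, y⟩, hy⟩ := y
    refine l2_norm_le_one_of_two_re_le _ fun ξ η => ?_
    set a : Matrix (Fin n) (Fin r) ℂ := B⁻¹ * of fun i k => ξ (i, k) with ha
    set b : Matrix (Fin n) (Fin r) ℂ := C⁻¹ * of fun j l => η (j, l) with hb
    have e : ∑ s, ∑ t, ξ s * pairMatrix (sandwich (B⁻¹)ᵀ φ C⁻¹) y s t * η t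
        = matrixPairing φ (sandwich a y bᵀ) := by
      have h1 := matrixPairing_sandwich φ B⁻¹
        (sandwich (of fun i k => ξ (i, k)) y (of fun l j => η (j, l))) (C⁻¹)ᵀ
      rw [transpose_transpose, sandwich_sandwich] at h1
      rw [sum_mul_pairMatrix_mul, ← h1, ha, hb, transpose_mul]
      rfl
    have hBa : B * a = of fun i k => ξ (i, k) := mul_nonsing_inv_cancel_left _ _ hBdet
    have hCb : C * b = of fun j l => η (j, l) := mul_nonsing_inv_cancel_left _ _ hCdet
    have h1 := hB r a
    have h2 := hC r b
    rw [hBa] at h1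
    rw [hCb] at h2
    have h3 := hcone r a b y hy
    rw [hpq] at h3
    have h4 : 0 ≤ ε * ∑ i, ∑ k, ‖a i k‖ ^ 2 := by positivity
    have h5 : 0 ≤ ε * ∑ i, ∑ k, ‖b i k‖ ^ 2 := by positivity
    rw [e, Fintype.sum_prod_type, Fintype.sum_prod_type]
    simp only [of_apply] at h1 h2
    linarith
  · rw [sandwich_sandwich, ← transpose_mul, nonsing_inv_mul _ hBdet, nonsing_inv_mul _ hCdet,
      transpose_one, one_sandwich_one]

/-- A functional of norm at most `c` on `M_n(E)` has norm at most `c` as a functional on `M_n(E**)`,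
where the norm of the latter space is that of `CB(E*, M_n)`. Equivalently, the unit ball of `M_n(E)`
is weak* dense in that of `M_n(E**)`. -/
theorem norm_matrixPairing_bidual_le {n : ℕ} {φ : Matrix (Fin n) (Fin n) (StrongDual ℂ E)} {c : ℝ}
    (hc : 0 ≤ c) (hφ : ∀ y, ‖matrixPairing φ y‖ ≤ c * mnorm y)
    (F : Matrix (Fin n) (Fin n) (StrongDual ℂ (StrongDual ℂ E))) :
    ‖matrixPairing F φ‖ ≤ c * mnorm F := by
  have key : ∀ ε : ℝ, 0 < ε → ‖matrixPairing F φ‖ ≤ (c + ε * n) * mnorm F := by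
    intro ε hε
    obtain ⟨B, C, f, hB, hC, hf, hfac⟩ := exists_factorization hc hφ hε
    set ξ : Fin n × Fin n → ℂ := fun s => B s.2 s.1
    set η : Fin n × Fin n → ℂ := fun s => C s.2 s.1
    have e : matrixPairing F φ = ∑ s, ∑ t, ξ s * pairMatrix F f s t * η t := by
      rw [sum_mul_pairMatrix_mul, hfac]
      rfl
    have hK : 0 ≤ c + ε * n := by positivity
    have hξ : ‖WithLp.toLp 2 ξ‖ ≤ √(c + ε * n) := by
      refine Real.le_sqrt_of_sq_le ?_
      rw [EuclideanSpace.norm_sq_eq, Fintype.sum_prod_type_right]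
      exact hB
    have hη : ‖WithLp.toLp 2 η‖ ≤ √(c + ε * n) := by
      refine Real.le_sqrt_of_sq_le ?_
      rw [EuclideanSpace.norm_sq_eq, Fintype.sum_prod_type_right]
      exact hC
    have hF : ‖pairMatrix F f‖ ≤ mnorm F := norm_pairMatrix_le F f hf
    have hF0 := mnorm_nonneg F
    rw [e]
    calc _ ≤ _ := bilin_le_l2 _ _ _
      _ ≤ mnorm F * √(c + ε * n) * √(c + ε * n) := by gcongr
      _ = _ := by rw [mul_assoc, Real.mul_self_sqrt hK, mul_comm]
  have h3 : Tendsto (fun ε : ℝ => (c + ε * n) * mnorm F) (𝓝[>] 0)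
      (𝓝 ((c + 0 * n) * mnorm F)) := by
    refine Tendsto.mono_left ?_ nhdsWithin_le_nhds
    exact (by fun_prop : Continuous fun ε : ℝ => (c + ε * n) * mnorm F).tendsto 0
  rw [zero_mul, add_zero] at h3
  exact ge_of_tendsto h3 (eventually_nhdsWithin_of_forall fun ε hε => key ε hε)

end MatrixPairing

/-! ### Complete `L`- and `M`-projections -/

section Complete

open scoped Matrix.Norms.L2Operator
open Matrix

variable {E : Type*} [NormedAddCommGroup E] [NormedSpace ℂ E] [OperatorSpace E]

theorem norm_selection_le {m n : ℕ} {e : Fin n → Fin m} (he : Function.Injective e) :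
    ‖(of fun i k => if e i = k then 1 else 0 : Matrix (Fin n) (Fin m) ℂ)‖ ≤ 1 := by
  refine l2_le_of_bilin _ zero_le_one fun ξ η => ?_
  have e1 : ∑ p, ∑ q, ξ p * (of fun i k => if e i = k then 1 else 0 : Matrix (Fin n) (Fin m) ℂ) p q
      * η q = inner ℂ (WithLp.toLp 2 fun i => star (ξ i)) (WithLp.toLp 2 fun i => η (e i)) := by
    simp [PiLp.inner_apply, mul_comm]
  have h1 : ‖WithLp.toLp 2 (fun p => star (ξ p))‖ = ‖WithLp.toLp 2 ξ‖ := by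
    simp [EuclideanSpace.norm_eq]
  have h2 : ‖WithLp.toLp 2 fun i => η (e i)‖ ≤ ‖WithLp.toLp 2 η‖ := by
    rw [EuclideanSpace.norm_eq, EuclideanSpace.norm_eq]
    refine Real.sqrt_le_sqrt ?_
    have h3 := Finset.sum_map Finset.univ ⟨e, he⟩ fun k => ‖η k‖ ^ 2
    refine (le_of_eq h3.symm).trans ?_
    exact Finset.sum_le_sum_of_subset_of_nonneg (Finset.subset_univ _) fun _ _ _ => by positivity
  rw [e1, one_mul]
  refine (norm_inner_le_norm _ _).trans ?_
  rw [h1]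
  gcongr

theorem mnorm_submatrix_le {m n : ℕ} {e : Fin n → Fin m} (he : Function.Injective e)
    (x : Matrix (Fin m) (Fin m) E) : mnorm (x.submatrix e e) ≤ mnorm x := by
  set A : Matrix (Fin n) (Fin m) ℂ := of fun i k => if e i = k then 1 else 0 with hA
  have h1 : x.submatrix e e = sandwich A x Aᵀ := by
    ext i j
    simp [sandwich, hA, ite_smul]
  have h2 : ‖A‖ ≤ 1 := norm_selection_le he
  have h3 : ‖Aᵀ‖ ≤ 1 := (norm_transpose_le A).trans h2
  have hx := mnorm_nonneg x
  rw [h1]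
  calc _ ≤ ‖A‖ * mnorm x * ‖Aᵀ‖ := OperatorSpace.mnorm_sandwich_le A x Aᵀ
    _ ≤ 1 * mnorm x * 1 := by gcongr
    _ = mnorm x := by ring

theorem submatrix_castAdd_directSum {E : Type*} [AddCommGroup E] {m n : ℕ}
    (x : Matrix (Fin m) (Fin m) E) (y : Matrix (Fin n) (Fin n) E) :
    (reindex finSumFinEquiv finSumFinEquiv (fromBlocks x 0 0 y)).submatrix
      (Fin.castAdd n) (Fin.castAdd n) = x := by
  ext
  simp

theorem submatrix_natAdd_directSum {E : Type*} [AddCommGroup E] {m n : ℕ}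
    (x : Matrix (Fin m) (Fin m) E) (y : Matrix (Fin n) (Fin n) E) :
    (reindex finSumFinEquiv finSumFinEquiv (fromBlocks x 0 0 y)).submatrix
      (Fin.natAdd m) (Fin.natAdd m) = y := by
  ext
  simp

omit [OperatorSpace E] in
theorem matrixPairing_directSum {m n : ℕ} (φ : Matrix (Fin m) (Fin m) (StrongDual ℂ E))
    (ψ : Matrix (Fin n) (Fin n) (StrongDual ℂ E)) (y : Matrix (Fin (m + n)) (Fin (m + n)) E) :
    matrixPairing (reindex finSumFinEquiv finSumFinEquiv (fromBlocks φ 0 0 ψ)) y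
      = matrixPairing φ (y.submatrix (Fin.castAdd n) (Fin.castAdd n))
        + matrixPairing ψ (y.submatrix (Fin.natAdd m) (Fin.natAdd m)) := by
  simp [matrixPairing, Fin.sum_univ_add]

theorem norm_pairMatrix_le_mul {n m : ℕ} (f : Matrix (Fin n) (Fin n) (StrongDual ℂ E))
    (y : Matrix (Fin m) (Fin m) E) : ‖pairMatrix f y‖ ≤ dualMnorm f * mnorm y := by
  have hy := mnorm_nonneg y
  have key : ∀ δ : ℝ, 0 < δ → ‖pairMatrix f y‖ ≤ dualMnorm f * (mnorm y + δ) := by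
    intro δ hδ
    have hK : 0 < mnorm y + δ := by positivity
    have h1 : mnorm (((mnorm y + δ)⁻¹ : ℂ) • y) ≤ 1 := by
      refine (OperatorSpace.mnorm_smul _ y).trans_le ?_
      change _ * mnorm y ≤ 1
      rw [← Complex.ofReal_add, norm_inv, Complex.norm_real, Real.norm_of_nonneg hK.le,
        inv_mul_le_iff₀ hK]
      linarith
    have h2 : pairMatrix f (((mnorm y + δ)⁻¹ : ℂ) • y)
        = ((mnorm y + δ)⁻¹ : ℂ) • pairMatrix f y := by
      ext p q
      simp [pairMatrix]
    have h3 := norm_pairMatrix_le f _ h1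
    rw [h2, norm_smul, ← Complex.ofReal_add, norm_inv, Complex.norm_real,
      Real.norm_of_nonneg hK.le, inv_mul_le_iff₀ hK] at h3
    linarith
  have h3 : Tendsto (fun δ : ℝ => dualMnorm f * (mnorm y + δ)) (𝓝[>] 0)
      (𝓝 (dualMnorm f * (mnorm y + 0))) := by
    refine Tendsto.mono_left ?_ nhdsWithin_le_nhds
    exact (by fun_prop : Continuous fun δ : ℝ => dualMnorm f * (mnorm y + δ)).tendsto 0
  rw [add_zero] at h3
  exact ge_of_tendsto h3 (eventually_nhdsWithin_of_forall fun δ hδ => key δ hδ)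

theorem norm_toLp_swap {ι κ : Type*} [Fintype ι] [Fintype κ] (ξ : ι × κ → ℂ) :
    ‖WithLp.toLp 2 fun p : κ × ι => ξ (p.2, p.1)‖ = ‖WithLp.toLp 2 ξ‖ := by
  rw [EuclideanSpace.norm_eq, EuclideanSpace.norm_eq, Fintype.sum_prod_type,
    Fintype.sum_prod_type_right]

/-- The product `ξ f η` with Hilbert-Schmidt matrices `ξ`, `η` is a functional on `M_n(E)` of norm at
most `‖ξ‖ ‖f‖ ‖η‖`. -/
theorem norm_matrixPairing_sandwich_le {n m : ℕ} (f : Matrix (Fin m) (Fin m) (StrongDual ℂ E))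
    (ξ η : Fin n × Fin m → ℂ) (y : Matrix (Fin n) (Fin n) E) :
    ‖matrixPairing (sandwich (of fun i k => ξ (i, k)) f (of fun l j => η (j, l))) y‖
      ≤ dualMnorm f * ‖WithLp.toLp 2 ξ‖ * ‖WithLp.toLp 2 η‖ * mnorm y := by
  have h1 := matrixPairing_sandwich f (of fun k i => ξ (i, k)) y (of fun j l => η (j, l))
  have h2 := sum_mul_pairMatrix_mul f y (fun p => ξ (p.2, p.1)) (fun q => η (q.2, q.1))
  have h3 : matrixPairing (sandwich (of fun i k => ξ (i, k)) f (of fun l j => η (j, l))) y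
      = ∑ p, ∑ q, ξ (p.2, p.1) * pairMatrix f y p q * η (q.2, q.1) := h1.symm.trans h2.symm
  rw [h3]
  refine (bilin_le_l2 (pairMatrix f y) (fun p => ξ (p.2, p.1)) (fun q => η (q.2, q.1))).trans ?_
  rw [norm_toLp_swap, norm_toLp_swap]
  have h4 := norm_pairMatrix_le_mul f y
  calc _ ≤ dualMnorm f * mnorm y * ‖WithLp.toLp 2 ξ‖ * ‖WithLp.toLp 2 η‖ := by gcongr
    _ = _ := by ring

theorem sandwich_map {E F : Type*} [NormedAddCommGroup E] [NormedSpace ℂ E]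
    [NormedAddCommGroup F] [NormedSpace ℂ F] {m n : ℕ} (S : E →L[ℂ] F)
    (a : Matrix (Fin n) (Fin m) ℂ) (x : Matrix (Fin m) (Fin m) E) (b : Matrix (Fin m) (Fin n) ℂ) :
    sandwich a (x.map S) b = (sandwich a x b).map S := by
  ext i j
  simp [sandwich, map_sum]

/-- If composition with `S` does not increase the norms of functionals on the spaces `M_m(E)`, then
`S` is a complete contraction of `E*`. -/
theorem mnorm_map_le_of_matrixPairing {S : StrongDual ℂ E →L[ℂ] StrongDual ℂ E}
    (hS : ∀ (m : ℕ) (φ : Matrix (Fin m) (Fin m) (StrongDual ℂ E)) (c : ℝ), 0 ≤ c →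
      (∀ y, ‖matrixPairing φ y‖ ≤ c * mnorm y) →
      ∀ y, ‖matrixPairing (φ.map S) y‖ ≤ c * mnorm y)
    {n : ℕ} (f : Matrix (Fin n) (Fin n) (StrongDual ℂ E)) : mnorm (f.map S) ≤ mnorm f := by
  refine ciSup_le fun y => ?_
  obtain ⟨⟨m, y⟩, hy⟩ := y
  refine l2_le_of_bilin _ (mnorm_nonneg f) fun ξ η => ?_
  have h1 := matrixPairing_sandwich (f.map S) (of fun i k => ξ (i, k)) y (of fun l j => η (j, l))
  rw [sandwich_map] at h1
  rw [sum_mul_pairMatrix_mul, h1]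
  have h2 := fun y => norm_matrixPairing_sandwich_le f (fun p => ξ (p.2, p.1))
    (fun p => η (p.2, p.1)) y
  rw [norm_toLp_swap, norm_toLp_swap] at h2
  have hf : 0 ≤ dualMnorm f := dualMnorm_nonneg f
  have h3 := hS m _ _ (by positivity) h2 y
  exact h3.trans (mul_le_of_le_one_right (by positivity) hy)

/-- The adjoint of a complete contraction is a complete contraction. -/
theorem mnorm_map_dualOp_le {S : E →L[ℂ] E}
    (hS : ∀ (n : ℕ) (x : Matrix (Fin n) (Fin n) E), mnorm (x.map S) ≤ mnorm x) {n : ℕ}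
    (f : Matrix (Fin n) (Fin n) (StrongDual ℂ E)) : mnorm (f.map (dualOp S)) ≤ mnorm f := by
  refine ciSup_le fun y => ?_
  exact norm_pairMatrix_le f (y.1.2.map S) ((hS _ _).trans y.2)

/-- `P` satisfies the matricial form of the inequality `‖P f‖ + ‖f - P f‖ ≤ ‖f‖`, written for
functionals on the spaces `M_n(E)`. -/
def IsMatricialLContraction (P : StrongDual ℂ E →L[ℂ] StrongDual ℂ E) : Prop :=
  ∀ (n : ℕ) (φ : Matrix (Fin n) (Fin n) (StrongDual ℂ E)) (c : ℝ), 0 ≤ c →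
    (∀ y, ‖matrixPairing φ y‖ ≤ c * mnorm y) → ∀ u v : Matrix (Fin n) (Fin n) E,
      ‖matrixPairing (φ.map P) u + matrixPairing (φ.map ⇑(1 - P)) v‖
        ≤ c * max (mnorm u) (mnorm v)

omit [OperatorSpace E] in
theorem TendstoWStarOT.tendsto_matrixPairing {ι : Type*} {l : Filter ι} {T : ι → E →L[ℂ] E}
    {P : StrongDual ℂ E →L[ℂ] StrongDual ℂ E} (hP : TendstoWStarOT (fun i => dualOp (T i)) l P)
    {n : ℕ} (φ : Matrix (Fin n) (Fin n) (StrongDual ℂ E)) (u v : Matrix (Fin n) (Fin n) E) :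
    Tendsto (fun i => matrixPairing φ (u.map (T i) + (v - v.map (T i)))) l
      (𝓝 (matrixPairing (φ.map P) u + matrixPairing (φ.map ⇑(1 - P)) v)) := by
  have e : matrixPairing (φ.map P) u + matrixPairing (φ.map ⇑(1 - P)) v
      = ∑ i, ∑ j, (P (φ i j) (u i j) + (φ i j - P (φ i j)) (v i j)) := by
    simp only [matrixPairing, Finset.sum_add_distrib]
    rfl
  rw [e]
  exact tendsto_finsetSum _ fun i _ => tendsto_finsetSum _ fun j _ =>
    hP.tendsto_mixed (φ i j) (u i j) (v i j)

theorem IsMcai.isMatricialLContraction {ι : Type*} [Preorder ι] [NeBot (atTop : Filter ι)]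
    {X : Submodule ℂ E} {T : ι → E →L[ℂ] E} (hT : IsMcai X T)
    {P : StrongDual ℂ E →L[ℂ] StrongDual ℂ E}
    (hP : TendstoWStarOT (fun i => dualOp (T i)) atTop P) : IsMatricialLContraction P := by
  intro n φ c hc hφ u v
  exact norm_le_of_limsup_ofReal_le le_rfl hc ((mnorm_nonneg u).trans (le_max_left _ _))
    (hP.tendsto_matrixPairing φ u v) (hT.limsup_le n u v) fun i => hφ _

theorem IsWeakContractiveMcai.isMatricialLContraction {ι : Type*} [Preorder ι]
    [NeBot (atTop : Filter ι)] {X : Submodule ℂ E} {T : ι → E →L[ℂ] E}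
    (hT : IsWeakContractiveMcai X T) {P : StrongDual ℂ E →L[ℂ] StrongDual ℂ E}
    (hP : TendstoWStarOT (fun i => dualOp (T i)) atTop P) (hPP : ∀ f, P (P f) = P f) :
    IsMatricialLContraction P := by
  intro n φ c hc hφ u v
  have key : ∀ u : Matrix (Fin n) (Fin n) E, (∀ i j, u i j ∈ X) →
      ‖matrixPairing (φ.map P) u + matrixPairing (φ.map ⇑(1 - P)) v‖
        ≤ c * max (mnorm u) (mnorm v) := fun u hu =>
    norm_le_of_limsup_ofReal_le le_rfl hc ((mnorm_nonneg u).trans (le_max_left _ _))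
      (hP.tendsto_matrixPairing φ u v) (hT.limsup_le n u v hu) fun i => hφ _
  -- the entries of `u` are moved into `X` by `T_α`, which is harmless as `P² = P`
  have h1 := hP.tendsto_matrixPairing (φ.map P) u 0
  have e1 : (φ.map P).map P = φ.map P := by
    ext i j : 1
    exact hPP (φ i j)
  have e2 : ∀ ψ : Matrix (Fin n) (Fin n) (StrongDual ℂ E), matrixPairing ψ 0 = 0 := by
    intro ψ
    simp [matrixPairing]
  rw [e1, e2, add_zero] at h1
  refine le_of_tendsto (h1.add_const (matrixPairing (φ.map ⇑(1 - P)) v)).norm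
    (Eventually.of_forall fun i => ?_)
  have e3 : u.map (T i) + ((0 : Matrix (Fin n) (Fin n) E) - Matrix.map 0 (T i)) = u.map (T i) := by
    ext
    simp
  rw [e3]
  refine (key _ fun _ _ => hT.mem i _).trans ?_
  gcongr
  exact hT.completelyContractive i n u

namespace IsMatricialLContraction

variable {P : StrongDual ℂ E →L[ℂ] StrongDual ℂ E} (hP : IsMatricialLContraction P)
include hP

theorem mnorm_map_le {n : ℕ} (f : Matrix (Fin n) (Fin n) (StrongDual ℂ E)) :
    mnorm (f.map P) ≤ mnorm f := by
  refine mnorm_map_le_of_matrixPairing (fun m φ c hc hφ y => ?_) f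
  have h1 := hP m φ c hc hφ y 0
  rw [mnorm_zero, max_eq_left (mnorm_nonneg y)] at h1
  simpa [matrixPairing] using h1

theorem mnorm_map_one_sub_le {n : ℕ} (f : Matrix (Fin n) (Fin n) (StrongDual ℂ E)) :
    mnorm (f.map ⇑(1 - P)) ≤ mnorm f := by
  refine mnorm_map_le_of_matrixPairing (fun m φ c hc hφ y => ?_) f
  have h1 := hP m φ c hc hφ 0 y
  rw [mnorm_zero, max_eq_right (mnorm_nonneg y)] at h1
  simpa [matrixPairing] using h1

/-- The defining estimate extends from `M_n(E)` to `M_n(E**)`: the functional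
`y ↦ ⟨Pφ, y₁₁⟩ + ⟨φ - Pφ, y₂₂⟩` on `M_{2n}(E)` has norm at most `c`, hence so has its extension to
`M_{2n}(E**)`, which is evaluated at the block diagonal matrix with blocks `F`, `G`. -/
theorem norm_bidual_le {n : ℕ} {φ : Matrix (Fin n) (Fin n) (StrongDual ℂ E)} {c : ℝ} (hc : 0 ≤ c)
    (hφ : ∀ y, ‖matrixPairing φ y‖ ≤ c * mnorm y)
    (F G : Matrix (Fin n) (Fin n) (StrongDual ℂ (StrongDual ℂ E))) :
    ‖matrixPairing F (φ.map P) + matrixPairing G (φ.map ⇑(1 - P))‖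
      ≤ c * max (mnorm F) (mnorm G) := by
  set ψ : Matrix (Fin (n + n)) (Fin (n + n)) (StrongDual ℂ E) :=
    reindex finSumFinEquiv finSumFinEquiv (fromBlocks (φ.map P) 0 0 (φ.map ⇑(1 - P))) with hψ
  have hψy : ∀ y, ‖matrixPairing ψ y‖ ≤ c * mnorm y := by
    intro y
    have e : matrixPairing ψ y
        = matrixPairing (φ.map P) (y.submatrix (Fin.castAdd n) (Fin.castAdd n))
          + matrixPairing (φ.map ⇑(1 - P)) (y.submatrix (Fin.natAdd n) (Fin.natAdd n)) :=
      matrixPairing_directSum _ _ y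
    rw [e]
    refine (hP n φ c hc hφ _ _).trans (mul_le_mul_of_nonneg_left (max_le ?_ ?_) hc)
    · exact mnorm_submatrix_le (Fin.castAdd_injective n n) y
    · exact mnorm_submatrix_le (Fin.natAdd_injective n n) y
  have h1 := norm_matrixPairing_bidual_le hc hψy
    (reindex finSumFinEquiv finSumFinEquiv (fromBlocks F 0 0 G))
  have e : matrixPairing (reindex finSumFinEquiv finSumFinEquiv (fromBlocks F 0 0 G)) ψ
      = matrixPairing F (φ.map P) + matrixPairing G (φ.map ⇑(1 - P)) := by
    rw [matrixPairing_directSum, hψ, submatrix_castAdd_directSum, submatrix_natAdd_directSum]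
  rw [e] at h1
  exact h1.trans (mul_le_mul_of_nonneg_left (OperatorSpace.mnorm_directSum_le F G) hc)

theorem isCompleteMSummand (hL : IsLprojection (StrongDual ℂ E) P) :
    IsCompleteMSummand (dualOp P).range := by
  refine ⟨(dualOp P).ker, (dualOp P).isClosed_ker, isCompl_range_ker_dualOp hL, ?_⟩
  intro n F G hF hG
  have hF' : ∀ i j f, F i j (P f) = F i j f := fun i j => (mem_range_dualOp_iff hL).1 (hF i j)
  have hG' : ∀ i j f, G i j (P f) = 0 := fun i j f =>
    DFunLike.congr_fun (LinearMap.mem_ker.1 (hG i j)) f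
  refine le_antisymm ?_ (max_le ?_ ?_)
  · refine ciSup_le fun f => ?_
    obtain ⟨⟨m, f⟩, hf⟩ := f
    have hmax : 0 ≤ max (mnorm F) (mnorm G) := (mnorm_nonneg F).trans (le_max_left _ _)
    refine l2_le_of_bilin _ hmax fun ξ η => ?_
    rw [sum_mul_pairMatrix_mul]
    set φ := sandwich (of fun i k => ξ (i, k)) f (of fun l j => η (j, l)) with hφ
    have e : matrixPairing (F + G) φ
        = matrixPairing F (φ.map P) + matrixPairing G (φ.map ⇑(1 - P)) := by
      simp only [matrixPairing, ← Finset.sum_add_distrib]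
      refine Finset.sum_congr rfl fun i _ => Finset.sum_congr rfl fun j _ => ?_
      change F i j (φ i j) + G i j (φ i j) = F i j (P (φ i j)) + G i j (φ i j - P (φ i j))
      rw [hF', map_sub, hG', sub_zero]
    have hc : 0 ≤ ‖WithLp.toLp 2 ξ‖ * ‖WithLp.toLp 2 η‖ := by positivity
    have h1 := hP.norm_bidual_le hc (φ := φ) (fun y => by
      refine (norm_matrixPairing_sandwich_le f ξ η y).trans ?_
      refine mul_le_mul_of_nonneg_right ?_ (mnorm_nonneg y)
      rw [mul_assoc]
      exact mul_le_of_le_one_left hc hf) F G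
    rw [e]
    exact h1.trans (le_of_eq (by ring))
  · have e : F = (F + G).map (dualOp P) := by
      ext i j f
      change F i j f = F i j (P f) + G i j (P f)
      rw [hF', hG', add_zero]
    conv_lhs => rw [e]
    exact mnorm_map_dualOp_le (fun _ => hP.mnorm_map_le) _
  · have e : G = (F + G).map (dualOp (1 - P)) := by
      ext i j f
      change G i j f = F i j (f - P f) + G i j (f - P f)
      rw [map_sub, map_sub, hF', hG', sub_self, zero_add, sub_zero]
    conv_lhs => rw [e]
    exact mnorm_map_dualOp_le (fun _ => hP.mnorm_map_one_sub_le) _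

end IsMatricialLContraction

end Complete

/-! ### Bounded bilinear forms on square summable families -/

section BilinearForms

variable {κ : Type*} {A : κ → κ → ℂ} {M : ℝ}

/-- The finite sections of the matrix `A` are bounded by `M` on `ℓ²(κ)`. -/
def IsSectionBounded (A : κ → κ → ℂ) (M : ℝ) : Prop :=
  ∀ (s t : Finset κ) (a b : κ → ℂ), ‖∑ p ∈ s, ∑ q ∈ t, a p * (A p q * b q)‖
    ≤ M * √(∑ p ∈ s, ‖a p‖ ^ 2) * √(∑ q ∈ t, ‖b q‖ ^ 2)

/-- Summability of a family of complex numbers follows from bounds on the finite sums which are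
stable under multiplying the terms by phases. -/
theorem summable_norm_of_phase_bound {z : κ → ℂ} {C : ℝ}
    (h : ∀ (θ : κ → ℂ), (∀ p, ‖θ p‖ = 1) → ∀ s : Finset κ, ‖∑ p ∈ s, θ p * z p‖ ≤ C) :
    Summable fun p => ‖z p‖ := by
  choose θ hθ hθ' using fun p => RCLike.exists_norm_eq_mul_self (z p)
  refine summable_of_sum_le (c := C) (fun p => norm_nonneg _) fun s => ?_
  have h1 := h θ hθ s
  simp only [← hθ'] at h1
  rw [← map_sum, RCLike.norm_ofReal] at h1
  exact (le_abs_self _).trans h1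

theorem sum_norm_sq_le_tsum {b : κ → ℂ} (hb : Summable fun q => ‖b q‖ ^ 2) (t : Finset κ) :
    ∑ q ∈ t, ‖b q‖ ^ 2 ≤ ∑' q, ‖b q‖ ^ 2 :=
  hb.sum_le_tsum t fun _ _ => by positivity

namespace IsSectionBounded

variable (hA : IsSectionBounded A M) (hM : 0 ≤ M)
include hA hM

theorem summable_row {b : κ → ℂ} (hb : Summable fun q => ‖b q‖ ^ 2) (p : κ) :
    Summable fun q => A p q * b q := by
  refine Summable.of_norm (summable_norm_of_phase_bound (C := M * √(∑' q, ‖b q‖ ^ 2))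
    fun θ hθ t => ?_)
  have h1 := hA {p} t (fun _ => 1) fun q => θ q * b q
  simp only [Finset.sum_singleton, norm_one, one_pow, Real.sqrt_one, mul_one, one_mul, norm_mul,
    hθ] at h1
  refine le_trans (le_of_eq ?_) (h1.trans ?_)
  · congr 1
    exact Finset.sum_congr rfl fun q _ => by ring
  · gcongr
    exact sum_norm_sq_le_tsum hb t

theorem tendsto_section {b : κ → ℂ} (hb : Summable fun q => ‖b q‖ ^ 2) (a : κ → ℂ)
    (s : Finset κ) : Tendsto (fun t : Finset κ => ∑ p ∈ s, ∑ q ∈ t, a p * (A p q * b q)) atTop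
      (𝓝 (∑ p ∈ s, a p * ∑' q, A p q * b q)) := by
  refine tendsto_finsetSum _ fun p _ => ?_
  simp only [← Finset.mul_sum]
  exact (hA.summable_row hM hb p).hasSum.const_mul (a p)

theorem norm_partial_le {a b : κ → ℂ} (hb : Summable fun q => ‖b q‖ ^ 2) (s : Finset κ) :
    ‖∑ p ∈ s, a p * ∑' q, A p q * b q‖
      ≤ M * √(∑ p ∈ s, ‖a p‖ ^ 2) * √(∑' q, ‖b q‖ ^ 2) := by
  refine le_of_tendsto (hA.tendsto_section hM hb a s).norm (Eventually.of_forall fun t => ?_)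
  refine (hA s t a b).trans ?_
  gcongr
  exact sum_norm_sq_le_tsum hb t

theorem summable_form {a b : κ → ℂ} (ha : Summable fun p => ‖a p‖ ^ 2)
    (hb : Summable fun q => ‖b q‖ ^ 2) : Summable fun p => a p * ∑' q, A p q * b q := by
  refine Summable.of_norm (summable_norm_of_phase_bound
    (C := M * √(∑' p, ‖a p‖ ^ 2) * √(∑' q, ‖b q‖ ^ 2)) fun θ hθ s => ?_)
  have h1 := hA.norm_partial_le hM (a := fun p => θ p * a p) hb s
  simp only [norm_mul, hθ, one_mul] at h1
  refine le_trans (le_of_eq ?_) (h1.trans ?_)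
  · congr 1
    exact Finset.sum_congr rfl fun p _ => by ring
  · gcongr
    exact sum_norm_sq_le_tsum ha s

/-- The finite sections approximate the form, at a rate that depends only on `M`, `a` and `b`. -/
theorem norm_form_sub_section_le {a b : κ → ℂ} (ha : Summable fun p => ‖a p‖ ^ 2)
    (hb : Summable fun q => ‖b q‖ ^ 2) {s t : Finset κ} {δ : ℝ}
    (hs : ∀ s', Disjoint s' s → √(∑ p ∈ s', ‖a p‖ ^ 2) ≤ δ)
    (ht : ∀ t', Disjoint t' t → √(∑ q ∈ t', ‖b q‖ ^ 2) ≤ δ) :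
    ‖(∑' p, a p * ∑' q, A p q * b q) - ∑ p ∈ s, ∑ q ∈ t, a p * (A p q * b q)‖
      ≤ M * δ * √(∑' q, ‖b q‖ ^ 2) + M * √(∑' p, ‖a p‖ ^ 2) * δ := by
  classical
  have hδ : 0 ≤ δ := (Real.sqrt_nonneg _).trans (hs ∅ (Finset.disjoint_empty_left _))
  refine le_of_tendsto ((hA.summable_form hM ha hb).hasSum.sub_const _).norm ?_
  filter_upwards [eventually_ge_atTop s] with s' hs'
  refine le_of_tendsto ((hA.tendsto_section hM hb a s').sub_const _).norm ?_
  filter_upwards [eventually_ge_atTop t] with t' ht'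
  have e : ∑ p ∈ s', ∑ q ∈ t', a p * (A p q * b q) - ∑ p ∈ s, ∑ q ∈ t, a p * (A p q * b q)
      = ∑ p ∈ s' \ s, ∑ q ∈ t', a p * (A p q * b q)
        + ∑ p ∈ s, ∑ q ∈ t' \ t, a p * (A p q * b q) := by
    have h1 := Finset.sum_sdiff (f := fun p => ∑ q ∈ t', a p * (A p q * b q)) hs'
    have h2 : ∑ p ∈ s, ∑ q ∈ t', a p * (A p q * b q)
        = ∑ p ∈ s, ∑ q ∈ t' \ t, a p * (A p q * b q)
          + ∑ p ∈ s, ∑ q ∈ t, a p * (A p q * b q) := by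
      rw [← Finset.sum_add_distrib]
      exact Finset.sum_congr rfl fun p _ => (Finset.sum_sdiff ht').symm
    rw [← h1, h2]
    ring
  rw [e]
  refine (norm_add_le _ _).trans (add_le_add ((hA _ _ a b).trans ?_) ((hA _ _ a b).trans ?_))
  · gcongr
    · exact hs _ Finset.sdiff_disjoint
    · exact sum_norm_sq_le_tsum hb t'
  · gcongr
    · exact sum_norm_sq_le_tsum ha s
    · exact ht _ Finset.sdiff_disjoint

end IsSectionBounded

theorem exists_finset_sqrt_sum_le {a : κ → ℂ} (ha : Summable fun p => ‖a p‖ ^ 2) {δ : ℝ}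
    (hδ : 0 < δ) : ∃ s : Finset κ, ∀ s', Disjoint s' s → √(∑ p ∈ s', ‖a p‖ ^ 2) ≤ δ := by
  obtain ⟨s, hs⟩ := summable_iff_vanishing_norm.1 ha (δ ^ 2) (by positivity)
  refine ⟨s, fun s' hs' => (Real.sqrt_le_left hδ.le).2 ?_⟩
  have h1 := (hs s' hs').le
  rwa [Real.norm_of_nonneg (Finset.sum_nonneg fun _ _ => by positivity)] at h1

/-- Entrywise convergence of eventually uniformly bounded matrices implies weak convergence of the
associated forms on `ℓ²`. -/
theorem tendsto_form_of_isSectionBounded {ι : Type*} {l : Filter ι} {B : ι → κ → κ → ℂ}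
    (hM : 0 ≤ M) (hB : ∀ᶠ i in l, IsSectionBounded (B i) M) (hA : IsSectionBounded A M)
    (hlim : ∀ p q, Tendsto (fun i => B i p q) l (𝓝 (A p q))) {a b : κ → ℂ}
    (ha : Summable fun p => ‖a p‖ ^ 2) (hb : Summable fun q => ‖b q‖ ^ 2) :
    Tendsto (fun i => ∑' p, a p * ∑' q, B i p q * b q) l (𝓝 (∑' p, a p * ∑' q, A p q * b q)) := by
  rw [Metric.tendsto_nhds]
  intro ε hε
  set K : ℝ := M * √(∑' q, ‖b q‖ ^ 2) + M * √(∑' p, ‖a p‖ ^ 2) with hK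
  have hK0 : 0 ≤ K := by positivity
  set δ : ℝ := ε / (3 * (K + 1)) with hδ
  have hδ0 : 0 < δ := by positivity
  have hKδ : M * δ * √(∑' q, ‖b q‖ ^ 2) + M * √(∑' p, ‖a p‖ ^ 2) * δ < ε / 3 := by
    have h1 : (K + 1) * δ = ε / 3 := by
      rw [hδ]
      field_simp
    have h2 : M * δ * √(∑' q, ‖b q‖ ^ 2) + M * √(∑' p, ‖a p‖ ^ 2) * δ = K * δ := by
      rw [hK]
      ring
    rw [h2]
    linarith
  obtain ⟨s, hs⟩ := exists_finset_sqrt_sum_le ha hδ0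
  obtain ⟨t, ht⟩ := exists_finset_sqrt_sum_le hb hδ0
  have hfin : Tendsto (fun i => ∑ p ∈ s, ∑ q ∈ t, a p * (B i p q * b q)) l
      (𝓝 (∑ p ∈ s, ∑ q ∈ t, a p * (A p q * b q))) :=
    tendsto_finsetSum _ fun p _ => tendsto_finsetSum _ fun q _ =>
      ((hlim p q).mul_const (b q)).const_mul (a p)
  have h0 := hA.norm_form_sub_section_le hM ha hb hs ht
  filter_upwards [hB, Metric.tendsto_nhds.1 hfin (ε / 3) (by positivity)] with i hi h2
  have h1 := hi.norm_form_sub_section_le hM ha hb hs ht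
  rw [← dist_eq_norm] at h0 h1
  rw [dist_comm] at h0
  have h3 := dist_triangle4 (∑' p, a p * ∑' q, B i p q * b q)
    (∑ p ∈ s, ∑ q ∈ t, a p * (B i p q * b q)) (∑ p ∈ s, ∑ q ∈ t, a p * (A p q * b q))
    (∑' p, a p * ∑' q, A p q * b q)
  linarith

end BilinearForms

/-! ### Infinite matrices -/

section InfiniteMatrices

open Matrix
open scoped Matrix.Norms.L2Operator

variable {E : Type*} [NormedAddCommGroup E] [NormedSpace ℂ E] [OperatorSpace E]

theorem infMnorm_le_ofReal_iff {τ : Matrix ℕ ℕ E} {C : ℝ} (hC : 0 ≤ C) :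
    infMnorm τ ≤ ENNReal.ofReal C ↔ ∀ n : ℕ, mnorm (of fun i j : Fin n => τ i j) ≤ C := by
  rw [infMnorm, iSup_le_iff]
  exact forall_congr' fun n => ENNReal.ofReal_le_ofReal_iff hC

theorem infMnorm_add_le (σ τ : Matrix ℕ ℕ E) : infMnorm (σ + τ) ≤ infMnorm σ + infMnorm τ := by
  refine iSup_le fun n => ?_
  have h1 : mnorm (of fun i j : Fin n => (σ + τ) i j)
      ≤ mnorm (of fun i j : Fin n => σ i j) + mnorm (of fun i j : Fin n => τ i j) :=
    OperatorSpace.mnorm_add_le (of fun i j : Fin n => σ i j) (of fun i j : Fin n => τ i j)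
  refine (ENNReal.ofReal_le_ofReal h1).trans ?_
  rw [ENNReal.ofReal_add (mnorm_nonneg _) (mnorm_nonneg _)]
  exact add_le_add
    (le_iSup (fun n : ℕ => ENNReal.ofReal (mnorm (of fun i j : Fin n => σ i j))) n)
    (le_iSup (fun n : ℕ => ENNReal.ofReal (mnorm (of fun i j : Fin n => τ i j))) n)

theorem infMnorm_map_le {F : Type*} [NormedAddCommGroup F] [NormedSpace ℂ F] [OperatorSpace F]
    {S : E → F} (hS : ∀ (n : ℕ) (x : Matrix (Fin n) (Fin n) E), mnorm (x.map S) ≤ mnorm x)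
    (τ : Matrix ℕ ℕ E) : infMnorm (τ.map S) ≤ infMnorm τ :=
  iSup_mono fun n => ENNReal.ofReal_le_ofReal (hS n (of fun i j : Fin n => τ i j))

theorem infMnorm_corner_le (n : ℕ) (τ : Matrix ℕ ℕ E) :
    infMnorm (corner n τ) ≤ ENNReal.ofReal (mnorm (of fun i j : Fin n => τ i j)) := by
  set x : Matrix (Fin n) (Fin n) E := of fun i j => τ i j with hx
  rw [infMnorm_le_ofReal_iff (mnorm_nonneg x)]
  intro m
  -- both `x` and the `m × m` corner are compressions of the `(n + m) × (n + m)` corner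
  set A : Matrix (Fin n) (Fin (n + m)) ℂ := of fun i k => if Fin.castAdd m i = k then 1 else 0
    with hA
  have hA1 : ‖A‖ ≤ 1 := norm_selection_le (Fin.castAdd_injective n m)
  have hA2 : ‖Aᵀ‖ ≤ 1 := (norm_transpose_le A).trans hA1
  have hne : ∀ (k : Fin n) (i : Fin m), Fin.castAdd m k ≠ Fin.natAdd n i := fun k i h => by
    have := congrArg Fin.val h
    simp only [Fin.val_castAdd, Fin.val_natAdd] at this
    omega
  have e1 : sandwich Aᵀ x A = of fun i j : Fin (n + m) => corner n τ i j := by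
    ext i j
    refine Fin.addCases (fun i => ?_) (fun i => ?_) i <;>
      refine Fin.addCases (fun j => ?_) (fun j => ?_) j <;>
      simp [sandwich, hA, hx, corner, ite_smul, hne]
  have e2 : (of fun i j : Fin m => corner n τ i j : Matrix (Fin m) (Fin m) E)
      = (sandwich Aᵀ x A).submatrix (Fin.castLE (Nat.le_add_left m n))
        (Fin.castLE (Nat.le_add_left m n)) := by
    rw [e1]
    rfl
  rw [e2]
  refine (mnorm_submatrix_le (Fin.castLE_injective _) _).trans ?_
  have hx0 := mnorm_nonneg x
  calc _ ≤ ‖Aᵀ‖ * mnorm x * ‖A‖ := OperatorSpace.mnorm_sandwich_le Aᵀ x A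
    _ ≤ 1 * mnorm x * 1 := by gcongr
    _ = mnorm x := by ring

theorem MemCompactTensor.infMnorm_lt_top {τ : Matrix ℕ ℕ E} (hτ : MemCompactTensor τ) :
    infMnorm τ < ⊤ := by
  obtain ⟨n, hn⟩ := (hτ.eventually_lt_const ENNReal.zero_lt_top).exists
  have h1 := infMnorm_add_le (τ - corner n τ) (corner n τ)
  rw [sub_add_cancel] at h1
  exact h1.trans_lt
    (ENNReal.add_lt_top.2 ⟨hn, (infMnorm_corner_le n τ).trans_lt ENNReal.ofReal_lt_top⟩)

/-- Complete contractions act on `𝒦 ⊗_op E`. -/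
theorem MemCompactTensor.map {F : Type*} [NormedAddCommGroup F] [NormedSpace ℂ F] [OperatorSpace F]
    {τ : Matrix ℕ ℕ E} (hτ : MemCompactTensor τ) {S : E →L[ℂ] F}
    (hS : ∀ (n : ℕ) (x : Matrix (Fin n) (Fin n) E), mnorm (x.map S) ≤ mnorm x) :
    MemCompactTensor (τ.map S) := by
  refine tendsto_of_tendsto_of_tendsto_of_le_of_le tendsto_const_nhds hτ (fun _ => zero_le)
    fun n => ?_
  have e : τ.map S - corner n (τ.map S) = (τ - corner n τ).map S := by
    ext i j
    by_cases h : i < n ∧ j < n <;> simp [corner, h]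
  change infMnorm (τ.map S - corner n (τ.map S)) ≤ infMnorm (τ - corner n τ)
  rw [e]
  exact infMnorm_map_le hS _

/-- The matrix `e₀₀ ⊗ f`, written as a corner of a constant matrix, belongs to `𝒦 ⊗_op E`. -/
theorem memCompactTensor_corner_one (f : E) : MemCompactTensor (corner 1 (of fun _ _ => f)) := by
  refine tendsto_const_nhds.congr' ?_
  filter_upwards [eventually_ge_atTop 1] with n hn
  have e : corner n (corner 1 (of fun _ _ => f)) = corner 1 (of fun _ _ => f) := by
    ext i j
    simp only [corner, of_apply]
    by_cases h : i < 1 ∧ j < 1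
    · rw [if_pos ⟨h.1.trans_le hn, h.2.trans_le hn⟩]
    · rw [if_neg h, ite_self]
  have h0 : ∀ m : ℕ, mnorm (of fun i j : Fin m => (0 : Matrix ℕ ℕ E) i j) = 0 :=
    fun m => mnorm_zero
  rw [e, sub_self, infMnorm]
  simp only [h0, ENNReal.ofReal_zero, ENNReal.iSup_zero]

theorem infMnorm_corner_one (f : E) : infMnorm (corner 1 (of fun _ _ => f)) = ‖f‖ₑ := by
  have h1 : mnorm (n := 1) (of fun _ _ => f) = ‖f‖ := OperatorSpace.mnorm_one f
  rw [← ofReal_norm, ← h1]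
  refine le_antisymm (infMnorm_corner_le 1 (of fun _ _ => f)) ?_
  refine le_trans (le_of_eq ?_) (le_iSup (fun n : ℕ => ENNReal.ofReal
    (mnorm (of fun i j : Fin n => corner 1 (of fun _ _ => f) i j))) 1)
  congr 2
  ext i j
  simp [corner]

omit [OperatorSpace E] in
theorem map_corner_one {F : Type*} [NormedAddCommGroup F] [NormedSpace ℂ F] (S : E →L[ℂ] F)
    (f : E) : (corner 1 (of fun _ _ => f)).map S = corner 1 (of fun _ _ => S f) := by
  ext i j
  simp only [corner, map_apply, of_apply]
  split_ifs
  · rfl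
  · exact map_zero S

theorem sum_fin_prod_ite {M : Type*} [AddCommMonoid M] {N : ℕ} {s : Finset (ℕ × ℕ)}
    (hs : s ⊆ Finset.range N ×ˢ Finset.range N) (h : ℕ × ℕ → M) :
    ∑ x : Fin N × Fin N, (if ((x.1 : ℕ), (x.2 : ℕ)) ∈ s then h (x.1, x.2) else 0)
      = ∑ p ∈ s, h p := by
  rw [Fintype.sum_prod_type,
    Fin.sum_univ_eq_sum_range (fun i => ∑ y : Fin N, if (i, (y : ℕ)) ∈ s then h (i, y) else 0)]
  simp only [fun i => Fin.sum_univ_eq_sum_range (fun j => if (i, j) ∈ s then h (i, j) else 0) N]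
  rw [← Finset.sum_product', Finset.sum_ite_mem, Finset.inter_eq_right.2 hs]

/-- If `μ` and `y` are bounded, so is the matrix `(μ_{ij}(y_{kl}))`. -/
theorem isSectionBounded_pairing {μ : Matrix ℕ ℕ (StrongDual ℂ E)} {y : Matrix ℕ ℕ E} {C D : ℝ}
    (hC : 0 ≤ C) (hD : 0 ≤ D) (hμ : infMnorm μ ≤ ENNReal.ofReal C)
    (hy : infMnorm y ≤ ENNReal.ofReal D) :
    IsSectionBounded (fun p q : ℕ × ℕ => μ p.1 q.1 (y p.2 q.2)) (C * D) := by
  intro s t a b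
  obtain ⟨N, hN⟩ : ∃ N, s ∪ t ⊆ Finset.range N ×ˢ Finset.range N := by
    refine ⟨(s ∪ t).sup (fun p => p.1 + p.2) + 1, fun p hp => ?_⟩
    have h1 : p.1 + p.2 ≤ (s ∪ t).sup (fun p => p.1 + p.2) :=
      Finset.le_sup (f := fun p : ℕ × ℕ => p.1 + p.2) hp
    rw [Finset.mem_product, Finset.mem_range, Finset.mem_range]
    omega
  have hsN := Finset.subset_union_left.trans hN
  have htN := Finset.subset_union_right.trans hN
  set f : Matrix (Fin N) (Fin N) (StrongDual ℂ E) := of fun i j => μ i j with hf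
  set z : Matrix (Fin N) (Fin N) E := of fun i j => y i j with hz
  set ξ : Fin N × Fin N → ℂ := fun x => if ((x.1 : ℕ), (x.2 : ℕ)) ∈ s then a (x.1, x.2) else 0
  set η : Fin N × Fin N → ℂ := fun x => if ((x.1 : ℕ), (x.2 : ℕ)) ∈ t then b (x.1, x.2) else 0
  have e : ∑ p ∈ s, ∑ q ∈ t, a p * (μ p.1 q.1 (y p.2 q.2) * b q)
      = ∑ p, ∑ q, ξ p * pairMatrix f z p q * η q := by
    rw [← sum_fin_prod_ite hsN]
    refine Finset.sum_congr rfl fun x _ => ?_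
    rw [← sum_fin_prod_ite htN]
    by_cases hx : ((x.1 : ℕ), (x.2 : ℕ)) ∈ s
    · rw [if_pos hx]
      refine Finset.sum_congr rfl fun w _ => ?_
      by_cases hw : ((w.1 : ℕ), (w.2 : ℕ)) ∈ t <;>
        simp [ξ, η, hx, hw, pairMatrix, hf, hz, mul_assoc]
    · simp [ξ, hx]
  have hξ : ‖WithLp.toLp 2 ξ‖ = √(∑ p ∈ s, ‖a p‖ ^ 2) := by
    rw [EuclideanSpace.norm_eq, ← sum_fin_prod_ite hsN]
    congr 1
    refine Finset.sum_congr rfl fun x _ => ?_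
    by_cases hx : ((x.1 : ℕ), (x.2 : ℕ)) ∈ s <;> simp [ξ, hx]
  have hη : ‖WithLp.toLp 2 η‖ = √(∑ q ∈ t, ‖b q‖ ^ 2) := by
    rw [EuclideanSpace.norm_eq, ← sum_fin_prod_ite htN]
    congr 1
    refine Finset.sum_congr rfl fun x _ => ?_
    by_cases hx : ((x.1 : ℕ), (x.2 : ℕ)) ∈ t <;> simp [η, hx]
  have h1 : ‖pairMatrix f z‖ ≤ C * D := (norm_pairMatrix_le_mul f z).trans
    (mul_le_mul ((infMnorm_le_ofReal_iff hC).1 hμ N) ((infMnorm_le_ofReal_iff hD).1 hy N)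
      (mnorm_nonneg _) hC)
  rw [e, ← hξ, ← hη]
  refine (bilin_le_l2 _ ξ η).trans ?_
  gcongr

theorem summable_lp_two (a : lp (fun _ : ℕ × ℕ => ℂ) 2) : Summable fun p => ‖a p‖ ^ 2 := by
  have h := (lp.memℓp a).summable (by norm_num)
  simpa using h

/-- Weak* convergence of `I_𝒦 ⊗ T_α**` follows from that of `T_α**`, as soon as the nets
`I_𝒦 ⊗ T_α*` are eventually bounded at every point of `𝒦 ⊗_op E*`. -/
theorem compactTendstoWStarOT_bidual {ι : Type*} {l : Filter ι}
    {S : ι → StrongDual ℂ E →L[ℂ] StrongDual ℂ E} {P : StrongDual ℂ E →L[ℂ] StrongDual ℂ E}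
    (hlim : TendstoWStarOT (fun i => dualOp (S i)) l (dualOp P))
    (hP : ∀ (n : ℕ) (f : Matrix (Fin n) (Fin n) (StrongDual ℂ E)), mnorm (f.map P) ≤ mnorm f)
    (hbd : ∀ y : Matrix ℕ ℕ (StrongDual ℂ E), MemCompactTensor y →
      ∃ D : ℝ≥0∞, D < ⊤ ∧ ∀ᶠ i in l, infMnorm (y.map (S i)) ≤ D) :
    CompactTendstoWStarOT (fun i => dualOp (S i)) l (dualOp P) := by
  intro μ hμ y hy a b
  obtain ⟨D, hDtop, hD⟩ := hbd y hy
  set C := (infMnorm μ).toReal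
  set K := (max D (infMnorm y)).toReal
  have hK' : max D (infMnorm y) < ⊤ := max_lt hDtop hy.infMnorm_lt_top
  have hμC : infMnorm μ ≤ ENNReal.ofReal C :=
    (ENNReal.ofReal_toReal hμ.infMnorm_lt_top.ne).ge
  have hKe : ENNReal.ofReal K = max D (infMnorm y) := ENNReal.ofReal_toReal hK'.ne
  have hC0 : 0 ≤ C := ENNReal.toReal_nonneg
  have hK0 : 0 ≤ K := ENNReal.toReal_nonneg
  have hentry : ∀ p q : ℕ × ℕ, Tendsto (fun i => μ p.1 q.1 (S i (y p.2 q.2))) l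
      (𝓝 (μ p.1 q.1 (P (y p.2 q.2)))) := fun p q =>
    tendstoWStarOT_iff.1 hlim (μ p.1 q.1) (y p.2 q.2)
  have hform := fun h1 h2 => tendsto_form_of_isSectionBounded (M := C * K) (by positivity) h1 h2
    hentry (summable_lp_two a) (summable_lp_two b)
  refine hform ?_ ?_
  · filter_upwards [hD] with i hi
    change IsSectionBounded (fun p q : ℕ × ℕ => μ p.1 q.1 (y.map (S i) p.2 q.2)) _
    refine isSectionBounded_pairing hC0 hK0 hμC ?_
    rw [hKe]
    exact hi.trans (le_max_left _ _)
  · change IsSectionBounded (fun p q : ℕ × ℕ => μ p.1 q.1 (y.map P p.2 q.2)) _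
    refine isSectionBounded_pairing hC0 hK0 hμC ?_
    rw [hKe]
    exact (infMnorm_map_le hP y).trans (le_max_right _ _)

end InfiniteMatrices

/-! ### From operator spaces to Banach spaces -/

section Forget

open Matrix

variable {E : Type*} [NormedAddCommGroup E] [NormedSpace ℂ E] [OperatorSpace E]
  {ι : Type*} [Preorder ι] {X : Submodule ℂ E} {T : ι → E →L[ℂ] E}

theorem mnorm_of_const (v : E) : mnorm (n := 1) (of fun _ _ => v) = ‖v‖ :=
  OperatorSpace.mnorm_one v

theorem IsMcai.isMai (hT : IsMcai X T) : IsMai X T := by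
  refine ⟨hT.bounded, hT.mem, hT.tendsto, fun u v => ?_⟩
  have h := hT.limsup_le 1 (of fun _ _ => u) (of fun _ _ => v)
  rw [mnorm_of_const, mnorm_of_const, ENNReal.ofReal_max, ofReal_norm, ofReal_norm] at h
  refine le_trans (le_of_eq ?_) h
  congr 1
  ext i
  rw [← ofReal_norm, ← mnorm_of_const]
  rfl

theorem IsWeakContractiveMcai.norm_le (hT : IsWeakContractiveMcai X T) (i : ι) : ‖T i‖ ≤ 1 := by
  refine (T i).opNorm_le_bound zero_le_one fun v => ?_
  have h := hT.completelyContractive i 1 (of fun _ _ => v)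
  rw [mnorm_of_const] at h
  rw [one_mul, ← mnorm_of_const (T i v)]
  exact h

theorem IsWeakContractiveMcai.isWeakContractiveMai (hT : IsWeakContractiveMcai X T) :
    IsWeakContractiveMai X T := by
  refine ⟨hT.norm_le, hT.mem, hT.tendsto, fun u hu v => ?_⟩
  have h := hT.limsup_le 1 (of fun _ _ => u) (of fun _ _ => v) fun _ _ => hu
  rw [mnorm_of_const, mnorm_of_const, ENNReal.ofReal_max, ofReal_norm, ofReal_norm] at h
  refine le_trans (le_of_eq ?_) h
  congr 1
  ext i
  rw [← ofReal_norm, ← mnorm_of_const]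
  rfl

/-- The bound for `T_α* f` is the one for `I_𝒦 ⊗ T_α*` at the matrix `e₀₀ ⊗ f`. -/
theorem IsStrongMcai.isStrongMai (hT : IsStrongMcai X T) : IsStrongMai X T := by
  refine ⟨hT.toIsMcai.isMai, hT.bidual, fun f => ?_⟩
  have h := hT.limsup_dual_le _ (memCompactTensor_corner_one f)
  simpa only [map_corner_one, infMnorm_corner_one] using h

/-- The nets `I_𝒦 ⊗ T_α*` are eventually bounded at every point of `𝒦 ⊗_op E*`: by `limsup_dual_le`
for strong approximate identities, and by contractivity for weak contractive ones. -/
theorem eventually_infMnorm_map_dualOp_le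
    (hT : IsStrongMcai X T ∨ (IsWeakContractiveMcai X T ∧ BidualTendsto X T))
    {y : Matrix ℕ ℕ (StrongDual ℂ E)} (hy : MemCompactTensor y) :
    ∃ D : ℝ≥0∞, D < ⊤ ∧ ∀ᶠ i in atTop, infMnorm (y.map (dualOp (T i))) ≤ D := by
  rcases hT with hT | ⟨hT, -⟩
  · refine ⟨infMnorm y + 1, ENNReal.add_lt_top.2 ⟨hy.infMnorm_lt_top, ENNReal.one_lt_top⟩, ?_⟩
    have h := (hT.limsup_dual_le y hy).trans_lt
      (ENNReal.lt_add_right hy.infMnorm_lt_top.ne one_ne_zero)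
    filter_upwards [eventually_lt_of_limsup_lt h] with i hi using hi.le
  · exact ⟨infMnorm y, hy.infMnorm_lt_top, Eventually.of_forall fun i =>
      infMnorm_map_le (fun n => mnorm_map_dualOp_le (hT.completelyContractive i)) y⟩

end Forget

theorem theorem1p1 :
    -- Banach spaces
    (∀ (𝕜 : Type*) [RCLike 𝕜] (Y : Type*) [NormedAddCommGroup Y] [NormedSpace 𝕜 Y]
        [CompleteSpace Y] (X : Submodule 𝕜 Y), IsClosed (X : Set Y) →
      ∀ (ι : Type*) [Preorder ι] [IsDirectedOrder ι] [Nonempty ι] (T : ι → Y →L[𝕜] Y),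
        IsMai X T ∨ IsWeakContractiveMai X T →
        IsMIdeal X ∧
        ∃ P : StrongDual 𝕜 Y →L[𝕜] StrongDual 𝕜 Y,
          (IsLprojection (StrongDual 𝕜 Y) P ∧ P.ker = annihilatorDual X ∧
            ∀ Q : StrongDual 𝕜 Y →L[𝕜] StrongDual 𝕜 Y,
              IsLprojection (StrongDual 𝕜 Y) Q → Q.ker = annihilatorDual X → Q = P) ∧
          TendstoWStarOT (fun α => dualOp (T α)) atTop P ∧
          IsMprojection (StrongDual 𝕜 (StrongDual 𝕜 Y)) (dualOp P) ∧
          (dualOp P).range = biannihilator X ∧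
          (IsStrongMai X T ∨ (IsWeakContractiveMai X T ∧ BidualTendsto X T) →
            TendstoWStarOT (fun α => dualOp (dualOp (T α))) atTop (dualOp P))) ∧
    -- operator spaces
    (∀ (Y : Type*) [NormedAddCommGroup Y] [NormedSpace ℂ Y] [CompleteSpace Y] [OperatorSpace Y]
        (X : Submodule ℂ Y), IsClosed (X : Set Y) →
      ∀ (ι : Type*) [Preorder ι] [IsDirectedOrder ι] [Nonempty ι] (T : ι → Y →L[ℂ] Y),
        IsMcai X T ∨ IsWeakContractiveMcai X T →
        IsCompleteMIdeal X ∧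
        ∃ P : StrongDual ℂ Y →L[ℂ] StrongDual ℂ Y,
          (IsLprojection (StrongDual ℂ Y) P ∧ P.ker = annihilatorDual X ∧
            ∀ Q : StrongDual ℂ Y →L[ℂ] StrongDual ℂ Y,
              IsLprojection (StrongDual ℂ Y) Q → Q.ker = annihilatorDual X → Q = P) ∧
          TendstoWStarOT (fun α => dualOp (T α)) atTop P ∧
          IsMprojection (StrongDual ℂ (StrongDual ℂ Y)) (dualOp P) ∧
          (dualOp P).range = biannihilator X ∧
          (IsStrongMcai X T ∨ (IsWeakContractiveMcai X T ∧ BidualTendsto X T) →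
            TendstoWStarOT (fun α => dualOp (dualOp (T α))) atTop (dualOp P) ∧
            (∀ μ : Matrix ℕ ℕ (StrongDual ℂ (StrongDual ℂ Y)), MemCompactTensor μ →
              MemCompactTensor (μ.map (dualOp P))) ∧
            CompactTendstoWStarOT (fun α => dualOp (dualOp (T α))) atTop (dualOp P))) := by
  refine ⟨?_, ?_⟩
  · intro 𝕜 _ Y _ _ _ X _ ι _ _ _ T hT
    obtain ⟨P, hP, hker, hlim⟩ := exists_isLprojection_tendsto hT
    have hrange := range_dualOp hP hker
    refine ⟨?_, P, ⟨hP, hker, fun Q hQ hQker => hP.eq_of_ker_eq hQ (hQker.trans hker.symm)⟩,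
      hlim, hP.isMprojection_dualOp, hrange, tendstoWStarOT_bidual_of_strong hP hker⟩
    have h := isMSummand_range_dualOp hP
    rwa [hrange] at h
  · intro Y _ _ _ _ X _ ι _ _ _ T hT
    obtain ⟨P, hP, hker, hlim⟩ := exists_isLprojection_tendsto
      (hT.imp IsMcai.isMai IsWeakContractiveMcai.isWeakContractiveMai)
    have hrange := range_dualOp hP hker
    have hmat : IsMatricialLContraction P :=
      hT.elim (·.isMatricialLContraction hlim) (·.isMatricialLContraction hlim hP.apply_apply)
    refine ⟨?_, P, ⟨hP, hker, fun Q hQ hQker => hP.eq_of_ker_eq hQ (hQker.trans hker.symm)⟩,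
      hlim, hP.isMprojection_dualOp, hrange, fun hstrong => ?_⟩
    · have h := hmat.isCompleteMSummand hP
      rwa [hrange] at h
    · have hbi := tendstoWStarOT_bidual_of_strong hP hker (hstrong.imp IsStrongMcai.isStrongMai
        fun h => ⟨h.1.isWeakContractiveMai, h.2⟩)
      exact ⟨hbi, fun μ hμ => hμ.map fun n => mnorm_map_dualOp_le fun _ => hmat.mnorm_map_le,
        compactTendstoWStarOT_bidual hbi (fun _ => hmat.mnorm_map_le)
          fun y hy => eventually_infMnorm_map_dualOp_le hstrong hy⟩
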